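/- For integers $n,m\ge 0$ and $p\in[0,1]$ let $G=G(n,m,p)$ be the binomial random intersection graph: $B(i,k)$ ($1\le i\le n$, $1\le k\le m$) are independent $\{0,1\}$-valued random variables with mean $p$, $V_i=\{k: B(i,k)=1\}$ is the attribute set of node $i$, and distinct nodes $i,j$ are adjacent if and only if $V_i\cap V_j\neq\emptyset$. Let $\lambda,\mu\in(0,\infty)$ be constants, and consider a sequence of such graphs with parameters $(n,m,p)=(n_\nu,m_\nu,p_\nu)$, $\nu=1,2,\dots$, in the balanced sparse regime $$n\to\infty,\qquad m\sim\frac{\mu^2}{\lambda}\,n,\qquad p\sim\frac{\lambda}{\mu}\,n^{-1}\qquad(\nu\to\infty).$$ For each $\nu$ let $V^{(n_0)}$ be a (possibly random) set of $n_0=n_{0,\nu}$ nodes of $G$, stochastically independent of $G$, and let $G^{(n_0)}$ be the subgraph of $G$ induced by $V^{(n_0)}$. Let $N_{K_2},N_{S_2},N_{K_3}$ denote the numbers of edges, of 2-stars (subgraphs isomorphic to the graph on $\{1,2,3\}$ with edges $12,13$), and of triangles in $G^{(n_0)}$, and define $$\hat\mu_1=\frac{N_{S_2}}{3N_{K_3}}-1,\qquad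 \hat\mu_2=\Bigl(\frac{n_0N_{S_2}}{2N_{K_2}^2}-1\Bigr)^{-1}.$$ If $n_0\gg n^{2/3}$, i.e. $n^{2/3}/n_0\to0$ as $\nu\to\infty$, then $\hat\mu_1$ and $\hat\mu_2$ are consistent estimators of $\mu$: for every $\varepsilon>0$, $$\mathbb P(|\hat\mu_1-\mu|\ge\varepsilon)\to0\quad\text{and}\quad \mathbb P(|\hat\mu_2-\mu|\ge\varepsilon)\to0\qquad(\nu\to\infty),$$ where the quotient or inverse is read as $0$ when its denominator is $0$ (this convention cannot help: it gives values at distance at least $\mu$ from $\mu$). -/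

import Mathlib

open MeasureTheory ProbabilityTheory Filter Topology Asymptotics

/-- The binary random variables `B i k` (`i` a node, `k` an attribute) are independent and have
mean `p`; they describe a random assignment of `m` attributes to `n` nodes. -/
structure IsBinomialAssignment {Ω : Type*} [MeasurableSpace Ω] (P : Measure Ω) (n m : ℕ) (p : ℝ)
    (B : Fin n → Fin m → Ω → ℕ) : Prop where
  measurable : ∀ i k, Measurable (B i k)
  zero_or_one : ∀ i k ω, B i k ω = 0 ∨ B i k ω = 1
  mean : ∀ i k, ∫ ω, (B i k ω : ℝ) ∂P = p
  indep : iIndepFun (fun ik : Fin n × Fin m => B ik.1 ik.2) P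

/-- The set of attributes of node `i`, when `b` is the assignment matrix. -/
def attributeSet {n m : ℕ} (b : Fin n → Fin m → ℕ) (i : Fin n) : Set (Fin m) :=
  {k | b i k = 1}

/-- The intersection graph of an assignment matrix: two distinct nodes are adjacent if and only if
they have a common attribute. -/
def intersectionGraph {n m : ℕ} (b : Fin n → Fin m → ℕ) : SimpleGraph (Fin n) where
  Adj i j := i ≠ j ∧ (attributeSet b i ∩ attributeSet b j).Nonempty
  symm := ⟨fun _ _ h => ⟨h.1.symm, by rw [Set.inter_comm]; exact h.2⟩⟩
  loopless := ⟨fun _ h => h.1 rfl⟩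

/-- The balanced sparse parameter regime with mean degree `lam` and attribute intensity `μ`:
`n → ∞`, `m ~ (μ² / lam) n` and `p ~ (lam / μ) n⁻¹`. -/
structure IsBalancedSparse (n m : ℕ → ℕ) (p : ℕ → ℝ) (lam μ : ℝ) : Prop where
  n_tendsto : Tendsto n atTop atTop
  m_equiv : (fun ν => (m ν : ℝ)) ~[atTop] fun ν => μ ^ 2 / lam * (n ν : ℝ)
  p_equiv : p ~[atTop] fun ν => lam / μ * (n ν : ℝ)⁻¹

/-- Number of edges. -/
noncomputable def numEdges {W : Type*} (H : SimpleGraph W) : ℕ :=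
  H.edgeSet.ncard

/-- Number of 2-stars: subgraphs isomorphic to the star with two leaves. -/
noncomputable def numTwoStars {W : Type*} [Fintype W] (H : SimpleGraph W) : ℕ :=
  H.copyCount (SimpleGraph.starGraph (0 : Fin 3))

/-- Number of triangles: subgraphs isomorphic to the complete graph on three nodes. -/
noncomputable def numTriangles {W : Type*} [Fintype W] (H : SimpleGraph W) : ℕ :=
  H.copyCount (SimpleGraph.completeGraph (Fin 3))

/-- The first moment estimator of the attribute intensity, computed from an observed graph.
If there is no triangle, the value in Lean is `-1`, which is never close to a positive number. -/
noncomputable def muHat₁ {W : Type*} [Fintype W] (H : SimpleGraph W) : ℝ :=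
  (numTwoStars H : ℝ) / (3 * (numTriangles H : ℝ)) - 1

/-- The second moment estimator of the attribute intensity, computed from an observed graph with
`Fintype.card W` nodes. Where the formula divides by zero, the value in Lean is `-1` or `0`, which
is never close to a given positive number. -/
noncomputable def muHat₂ {W : Type*} [Fintype W] (H : SimpleGraph W) : ℝ :=
  ((Fintype.card W : ℝ) * (numTwoStars H : ℝ) / (2 * (numEdges H : ℝ) ^ 2) - 1)⁻¹

/-- Convergence in probability to a constant, of random variables `X ν` that may live on
different probability spaces. -/
def TendstoInProbability {Ω : ℕ → Type*} [∀ ν, MeasurableSpace (Ω ν)] (P : ∀ ν, Measure (Ω ν))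
    (X : ∀ ν, Ω ν → ℝ) (c : ℝ) : Prop :=
  ∀ ε : ℝ, 0 < ε → Tendsto (fun ν => P ν {ω | ε ≤ |X ν ω - c|}) atTop (𝓝 0)

/-! Write `N` for the size of the sampled node set. The node set is independent of the graph, so it
suffices to bound probabilities for a fixed set of size `N`, uniformly over such sets. Such a graph
comes from a Boolean matrix whose entries are independent with mean `p`, so the columns `ω k` (one
per attribute) are independent and identically distributed.

The heart of the matter is a law of large numbers in L¹: `2 N_{K₂} / (N² n⁻¹) → λ`, `6 N_{K₃} / (N³
n⁻²) → λ² / μ` and `2 N_{S₂} / (N³ n⁻²) → λ² + λ² / μ`. Both estimators are functions of these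
normalized counts, continuous at the limit point and equal to `μ` there, so Markov's inequality
finishes the proof.

For the law of large numbers, adjacency of `i` and `j` is replaced by the number `C i j` of common
attributes, and a triangle by the number of attributes shared by all three nodes. The errors are
supported on coincidences (a pair with two common attributes, or a triangle made by three different
attributes); their expectations are of smaller order than the main terms (`abs_link_sub_le`,
`abs_link_mul_link_sub_le`, `abs_link_mul_link_mul_link_sub_le`).

With `X_k` the number of nodes carrying attribute `k`, the linearized edge and triangle counts are
the i.i.d. sums of `X_k(X_k-1)` and `X_k(X_k-1)(X_k-2)`, controlled by their variance. The
linearized 2-star count (`tripleSum_commonCount_mul`) is the same third-order sum, for stars made by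
one attribute, plus a sum over pairs of different attributes, plus a small correction. The pair sum
is a U-statistic: centering its kernel (`sum_offDiag_eq_sub_const`) leaves a constant, a multiple of
the edge deviation, and a degenerate quadratic form whose second moment is governed by squared
covariances of `colDegree` (`integral_pi_sum_offDiag_sq_le`).

All standard deviations are at most of the order of the square root of the scale, `N² n⁻¹` or `N³
n⁻²`. Hence relative errors vanish once `N³ n⁻² → ∞`, which is exactly `N ≫ n^(2/3)`. -/

namespace SimpleGraph

/-! ### Subgraph counts as sums over ordered tuples of nodes -/

variable {V W : Type*}

/-- A copy of `H` in `G` is a subgraph of `G` together with an isomorphism from `H`. -/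
noncomputable def copyEquivSigma (H : SimpleGraph W) (G : SimpleGraph V) :
    (Σ G' : G.Subgraph, H ≃g G'.coe) ≃ Copy H G :=
  Equiv.ofBijective (fun s => s.1.coeCopy.comp s.2.toCopy) <| by
    constructor
    · rintro ⟨G₁, e₁⟩ ⟨G₂, e₂⟩ h
      have h0 : ∀ w, ((e₁ w : G₁.verts) : V) = (e₂ w : G₂.verts) := fun w => congrArg (fun f => f w) h
      have hG : G₁ = G₂ := by
        have key : ∀ (G₁ G₂ : G.Subgraph) (e₁ : H ≃g G₁.coe) (e₂ : H ≃g G₂.coe),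
            (∀ w, ((e₁ w : G₁.verts) : V) = (e₂ w : G₂.verts)) → G₁ ≤ G₂ := by
          intro G₁ G₂ e₁ e₂ h
          refine ⟨fun v hv => ?_, fun v w hvw => ?_⟩
          · have := h (e₁.symm ⟨v, hv⟩)
            rw [RelIso.apply_symm_apply] at this
            change v = _ at this
            rw [this]
            exact Subtype.coe_prop _
          · have h1 := h (e₁.symm ⟨v, G₁.edge_vert hvw⟩)
            have h2 := h (e₁.symm ⟨w, G₁.edge_vert hvw.symm⟩)
            rw [RelIso.apply_symm_apply] at h1 h2
            change v = _ at h1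
            change w = _ at h2
            have h3 : G₂.coe.Adj (e₂ (e₁.symm ⟨v, G₁.edge_vert hvw⟩))
                (e₂ (e₁.symm ⟨w, G₁.edge_vert hvw.symm⟩)) := by
              rw [Iso.map_adj_iff, Iso.map_adj_iff]
              exact hvw
            rw [Subgraph.coe_adj] at h3
            rwa [← h1, ← h2] at h3
        exact le_antisymm (key _ _ _ _ h0) (key _ _ _ _ fun w => (h0 w).symm)
      subst hG
      congr 1
      ext w
      exact h0 w
    · intro f
      exact ⟨⟨f.toSubgraph, f.isoToSubgraph⟩, rfl⟩

/-- Sort labelled copies by their image subgraph: each fibre is empty or, after fixing one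
isomorphism, in bijection with the automorphisms of `H`. -/
theorem card_copy_eq [Fintype V] [Fintype W] (H : SimpleGraph W) (G : SimpleGraph V) :
    Nat.card (Copy H G) = Nat.card (H ≃g H) * G.copyCount H := by
  classical
  have hfin : ∀ G' : G.Subgraph, Finite (H ≃g G'.coe) := fun G' =>
    Finite.of_injective (fun e => (e : W → G'.verts)) DFunLike.coe_injective
  rw [← Nat.card_congr (copyEquivSigma H G), Nat.card_sigma, copyCount, Finset.card_filter,
    Finset.mul_sum]
  refine Finset.sum_congr rfl fun G' _ => ?_
  split_ifs with h
  · obtain ⟨e⟩ := h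
    rw [mul_one]
    exact Nat.card_congr ⟨fun f => f.trans e.symm, fun f => f.trans e,
      fun f => by ext w; simp, fun f => by ext w; simp⟩
  · rw [mul_zero, Nat.card_eq_zero]
    exact Or.inl (not_nonempty_iff.1 h)

/-- Automorphisms as permutations. -/
def autEquivPerm (H : SimpleGraph W) :
    (H ≃g H) ≃ {σ : Equiv.Perm W // ∀ a b, H.Adj (σ a) (σ b) ↔ H.Adj a b} where
  toFun e := ⟨e.toEquiv, fun _ _ => e.map_adj_iff⟩
  invFun σ := ⟨σ.1, fun {a b} => σ.2 a b⟩
  left_inv _ := rfl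
  right_inv _ := rfl

theorem card_aut_star : Nat.card (starGraph (0 : Fin 3) ≃g starGraph (0 : Fin 3)) = 2 := by
  rw [Nat.card_congr (autEquivPerm _), Nat.card_eq_fintype_card]
  decide

theorem card_aut_completeGraph :
    Nat.card (completeGraph (Fin 3) ≃g completeGraph (Fin 3)) = 6 := by
  rw [Nat.card_congr (autEquivPerm _), Nat.card_eq_fintype_card]
  decide

/-- Copies of a graph on three nodes, as ordered triples. -/
def copyEquivTriples (H : SimpleGraph (Fin 3)) (G : SimpleGraph V) :
    Copy H G ≃ {t : V × V × V // t.1 ≠ t.2.1 ∧ t.1 ≠ t.2.2 ∧ t.2.1 ≠ t.2.2 ∧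
      (H.Adj 0 1 → G.Adj t.1 t.2.1) ∧ (H.Adj 0 2 → G.Adj t.1 t.2.2) ∧
      (H.Adj 1 2 → G.Adj t.2.1 t.2.2)} where
  toFun f := ⟨(f 0, f 1, f 2), f.injective.ne (by decide), f.injective.ne (by decide),
    f.injective.ne (by decide), fun h => f.toHom.map_adj h, fun h => f.toHom.map_adj h,
    fun h => f.toHom.map_adj h⟩
  invFun t := ⟨⟨![t.1.1, t.1.2.1, t.1.2.2], by
      obtain ⟨⟨x, y, z⟩, h1, h2, h3, h4, h5, h6⟩ := t
      intro a b hab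
      fin_cases a <;> fin_cases b
      · exact (H.loopless.irrefl _ hab).elim
      · exact h4 hab
      · exact h5 hab
      · exact (h4 hab.symm).symm
      · exact (H.loopless.irrefl _ hab).elim
      · exact h6 hab
      · exact (h5 hab.symm).symm
      · exact (h6 hab.symm).symm
      · exact (H.loopless.irrefl _ hab).elim⟩, by
      obtain ⟨⟨x, y, z⟩, h1, h2, h3, -⟩ := t
      intro a b hab
      change ![x, y, z] a = ![x, y, z] b at hab
      fin_cases a <;> fin_cases b <;> simp_all [eq_comm]⟩
  left_inv f := by
    ext a
    fin_cases a <;> rfl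
  right_inv t := rfl

variable [Fintype V]

/-- The first index is the centre; the factor 2 is the swap of the two leaves. -/
theorem two_mul_numTwoStars [DecidableEq V] (G : SimpleGraph V) [DecidableRel G.Adj] :
    2 * (numTwoStars G : ℝ) = ∑ i, ∑ j, ∑ l,
      if i ≠ j ∧ i ≠ l ∧ j ≠ l ∧ G.Adj i j ∧ G.Adj i l then (1 : ℝ) else 0 := by
  have h := card_copy_eq (starGraph (0 : Fin 3)) G
  rw [card_aut_star, Nat.card_congr (copyEquivTriples _ G), Nat.card_eq_fintype_card,
    Fintype.card_subtype, Finset.card_filter, Fintype.sum_prod_type] at h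
  simp_rw [Fintype.sum_prod_type] at h
  have h' := congrArg (Nat.cast (R := ℝ)) h
  push_cast at h'
  rw [numTwoStars, ← h']
  refine Finset.sum_congr rfl fun i _ => Finset.sum_congr rfl fun j _ =>
    Finset.sum_congr rfl fun l _ => ?_
  simp [starGraph_adj]

theorem six_mul_numTriangles [DecidableEq V] (G : SimpleGraph V) [DecidableRel G.Adj] :
    6 * (numTriangles G : ℝ) = ∑ i, ∑ j, ∑ l,
      if i ≠ j ∧ i ≠ l ∧ j ≠ l ∧ G.Adj i j ∧ G.Adj i l ∧ G.Adj j l then (1 : ℝ) else 0 := by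
  have h := card_copy_eq (completeGraph (Fin 3)) G
  rw [card_aut_completeGraph, Nat.card_congr (copyEquivTriples _ G), Nat.card_eq_fintype_card,
    Fintype.card_subtype, Finset.card_filter, Fintype.sum_prod_type] at h
  simp_rw [Fintype.sum_prod_type] at h
  have h' := congrArg (Nat.cast (R := ℝ)) h
  push_cast at h'
  rw [numTriangles, ← h']
  refine Finset.sum_congr rfl fun i _ => Finset.sum_congr rfl fun j _ =>
    Finset.sum_congr rfl fun l _ => ?_
  simp

theorem two_mul_numEdges [DecidableEq V] (G : SimpleGraph V) [DecidableRel G.Adj] :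
    2 * (numEdges G : ℝ) = ∑ i, ∑ j, if G.Adj i j then (1 : ℝ) else 0 := by
  have h := G.sum_degrees_eq_twice_card_edges
  have h2 : numEdges G = G.edgeFinset.card := by
    rw [numEdges, ← coe_edgeFinset, Set.ncard_coe_finset]
  rw [h2]
  have h' := congrArg (Nat.cast (R := ℝ)) h
  push_cast at h'
  rw [← h']
  refine Finset.sum_congr rfl fun i _ => ?_
  rw [← card_neighborFinset_eq_degree, neighborFinset_eq_filter, Finset.card_filter]
  push_cast
  rfl

end SimpleGraph

/-! ### Expectations of products over independent coordinates -/

section Pi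

variable {κ α : Type*} [Fintype κ] [MeasurableSpace α] (γ : Measure α) [IsProbabilityMeasure γ]

/-- Pad the product with the constant 1 outside `s`; those factors integrate to 1 because `γ` is a
probability measure. -/
theorem integral_pi_finsetProd (f : κ → α → ℝ) (s : Finset κ) :
    ∫ ω : κ → α, ∏ k ∈ s, f k (ω k) ∂Measure.pi (fun _ => γ) = ∏ k ∈ s, ∫ a, f k a ∂γ := by
  classical
  have h := integral_fintype_prod_eq_prod (μ := fun _ : κ => γ)
    (f := fun k a => if k ∈ s then f k a else 1)
  have h1 : ∀ ω : κ → α, ∏ k ∈ s, f k (ω k) = ∏ k, if k ∈ s then f k (ω k) else 1 := by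
    intro ω
    rw [Finset.prod_ite_mem, Finset.univ_inter]
  simp_rw [h1]
  rw [h, Finset.prod_congr rfl (g := fun k => if k ∈ s then ∫ a, f k a ∂γ else 1),
    Finset.prod_ite_mem, Finset.univ_inter]
  intro k _
  split_ifs with hk <;> simp

theorem integral_pi_eval (φ : α → ℝ) (k : κ) :
    ∫ ω : κ → α, φ (ω k) ∂Measure.pi (fun _ => γ) = ∫ a, φ a ∂γ := by
  simpa using integral_pi_finsetProd γ (fun _ => φ) {k}

theorem integral_pi_mul (φ ψ : α → ℝ) {k l : κ} (h : k ≠ l) :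
    ∫ ω : κ → α, φ (ω k) * ψ (ω l) ∂Measure.pi (fun _ => γ) = (∫ a, φ a ∂γ) * ∫ a, ψ a ∂γ := by
  classical
  have := integral_pi_finsetProd γ (fun q => if q = k then φ else ψ) {k, l}
  simpa [Finset.prod_pair h, h.symm] using this

theorem integral_pi_mul_mul (φ ψ χ : α → ℝ) {k l q : κ} (h : k ≠ l) (h' : k ≠ q) (h'' : l ≠ q) :
    ∫ ω : κ → α, φ (ω k) * ψ (ω l) * χ (ω q) ∂Measure.pi (fun _ => γ) =
      (∫ a, φ a ∂γ) * (∫ a, ψ a ∂γ) * ∫ a, χ a ∂γ := by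
  classical
  have := integral_pi_finsetProd γ (fun r => if r = k then φ else if r = l then ψ else χ) {k, l, q}
  have e : ∀ F : κ → ℝ, ∏ i ∈ ({k, l, q} : Finset κ), F i = F k * F l * F q := by
    intro F
    rw [Finset.prod_insert (by simp [h, h']), Finset.prod_pair h'', mul_assoc]
  simpa [e, h.symm, h'.symm, h''.symm] using this

end Pi

/-! ### Moments of a single attribute column -/

section Column

variable {ι : Type*}

/-- The indicator that the node `i` has the attribute with column `c`. -/
def bit (c : ι → Bool) (i : ι) : ℝ := if c i then 1 else 0

theorem bit_mul_self (c : ι → Bool) (i : ι) : bit c i * bit c i = bit c i := by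
  simp [bit]

theorem bit_nonneg (c : ι → Bool) (i : ι) : 0 ≤ bit c i := by
  unfold bit; split_ifs <;> norm_num

theorem bit_le_one (c : ι → Bool) (i : ι) : bit c i ≤ 1 := by
  unfold bit; split_ifs <;> norm_num

variable [Fintype ι]

/-- The number of nodes that have the attribute with column `c`. -/
def colCount (c : ι → Bool) : ℕ := (Finset.univ.filter fun i => c i = true).card

theorem sum_bit (c : ι → Bool) : ∑ i, bit c i = colCount c := by
  simp [bit, colCount]

variable (ν : Measure Bool) [IsProbabilityMeasure ν]

theorem integral_prod_bit (s : Finset ι) :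
    ∫ c : ι → Bool, ∏ i ∈ s, bit c i ∂Measure.pi (fun _ => ν) = ν.real {true} ^ s.card := by
  have h := integral_pi_finsetProd ν (fun (_ : ι) (b : Bool) => if b then (1 : ℝ) else 0) s
  have h1 : ∫ b, (if b then (1 : ℝ) else 0) ∂ν = ν.real {true} := by
    rw [integral_fintype (Integrable.of_finite)]
    simp
  simpa [bit, h1] using h

/-- The binomial coefficient counts the `r`-sets of nodes that all carry the attribute, and each
given set does so with probability `p ^ r`. -/
theorem integral_choose_colCount (r : ℕ) :
    ∫ c : ι → Bool, ((colCount c).choose r : ℝ) ∂Measure.pi (fun _ => ν) =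
      ((Fintype.card ι).choose r : ℝ) * ν.real {true} ^ r := by
  classical
  have h1 : ∀ c : ι → Bool, ((colCount c).choose r : ℝ) =
      ∑ s ∈ Finset.powersetCard r Finset.univ, ∏ i ∈ s, bit c i := by
    intro c
    rw [colCount, ← Finset.card_powersetCard]
    have : ∀ s : Finset ι, ∏ i ∈ s, bit c i = if s ⊆ Finset.univ.filter (fun i => c i = true)
        then 1 else 0 := by
      intro s
      split_ifs with hs
      · exact Finset.prod_eq_one fun i hi => by
          have := hs hi
          simp at this
          simp [bit, this]
      · obtain ⟨i, hi, hi'⟩ := Finset.not_subset.1 hs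
        exact Finset.prod_eq_zero hi (by simpa [bit] using hi')
    simp_rw [this]
    rw [← Finset.sum_filter, Finset.sum_const, nsmul_eq_mul, mul_one]
    congr 2
    ext s
    simp only [Finset.mem_powersetCard, Finset.mem_filter, Finset.subset_univ, true_and]
    tauto
  simp_rw [h1]
  rw [integral_finsetSum _ fun _ _ => Integrable.of_finite,
    Finset.sum_congr rfl (g := fun _ => ν.real {true} ^ r)]
  · simp
  · intro s hs
    rw [integral_prod_bit, (Finset.mem_powersetCard.1 hs).2]

theorem integral_descFactorial_colCount (r : ℕ) :
    ∫ c : ι → Bool, ((colCount c).descFactorial r : ℝ) ∂Measure.pi (fun _ => ν) =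
      ((Fintype.card ι).descFactorial r : ℝ) * ν.real {true} ^ r := by
  simp_rw [Nat.descFactorial_eq_factorial_mul_choose]
  push_cast
  rw [integral_const_mul, integral_choose_colCount, mul_assoc]

/-- Real subtraction is harmless also for `k > n`, where both falling factorials vanish. Identities
between falling factorials thereby become `ring` goals. -/
theorem cast_descFactorial_succ (n k : ℕ) :
    ((n.descFactorial (k + 1) : ℕ) : ℝ) = ((n : ℝ) - k) * (n.descFactorial k : ℕ) := by
  rw [Nat.descFactorial_succ]
  rcases le_or_gt k n with h | h
  · push_cast [Nat.cast_sub h]; ring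
  · simp [Nat.descFactorial_of_lt h]

theorem integral_descFactorial_colCount_le (r : ℕ) :
    ∫ c : ι → Bool, ((colCount c).descFactorial r : ℝ) ∂Measure.pi (fun _ => ν) ≤
      ((Fintype.card ι : ℝ) * ν.real {true}) ^ r := by
  rw [integral_descFactorial_colCount, mul_pow]
  gcongr
  exact_mod_cast Nat.descFactorial_le_pow _ _

theorem cast_descFactorial_two (n : ℕ) : (n.descFactorial 2 : ℝ) = n * (n - 1) := by
  simp only [cast_descFactorial_succ, Nat.descFactorial_zero]; push_cast; ring

theorem cast_descFactorial_three (n : ℕ) :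
    (n.descFactorial 3 : ℝ) = n * (n - 1) * (n - 2) := by
  simp only [cast_descFactorial_succ, Nat.descFactorial_zero]; push_cast; ring

theorem integral_descFactorial_two_sq_le :
    ∫ c : ι → Bool, ((colCount c).descFactorial 2 : ℝ) ^ 2 ∂Measure.pi (fun _ => ν) ≤
      ((Fintype.card ι : ℝ) * ν.real {true}) ^ 4 + 4 * ((Fintype.card ι : ℝ) * ν.real {true}) ^ 3 +
        2 * ((Fintype.card ι : ℝ) * ν.real {true}) ^ 2 := by
  -- Pairs of ordered pairs, sorted by the size of their overlap: overlap `k` contributes `k! * (2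
  -- choose k) ^ 2`, giving 1, 4, 2.
  have h : ∀ n : ℕ, (n.descFactorial 2 : ℝ) ^ 2 =
      n.descFactorial 4 + 4 * n.descFactorial 3 + 2 * n.descFactorial 2 := by
    intro n
    simp only [cast_descFactorial_succ, Nat.descFactorial_zero]; push_cast; ring
  simp_rw [h]
  rw [integral_add .of_finite .of_finite, integral_add .of_finite .of_finite,
    integral_const_mul, integral_const_mul]
  gcongr <;> exact integral_descFactorial_colCount_le ν _

theorem integral_descFactorial_three_sq_le :
    ∫ c : ι → Bool, ((colCount c).descFactorial 3 : ℝ) ^ 2 ∂Measure.pi (fun _ => ν) ≤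
      ((Fintype.card ι : ℝ) * ν.real {true}) ^ 6 + 9 * ((Fintype.card ι : ℝ) * ν.real {true}) ^ 5 +
        18 * ((Fintype.card ι : ℝ) * ν.real {true}) ^ 4 +
        6 * ((Fintype.card ι : ℝ) * ν.real {true}) ^ 3 := by
  -- Same overlap expansion with coefficients `k! * (3 choose k) ^ 2`.
  have h : ∀ n : ℕ, (n.descFactorial 3 : ℝ) ^ 2 =
      n.descFactorial 6 + 9 * n.descFactorial 5 + 18 * n.descFactorial 4 +
        6 * n.descFactorial 3 := by
    intro n
    simp only [cast_descFactorial_succ, Nat.descFactorial_zero]; push_cast; ring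
  simp_rw [h]
  rw [integral_add .of_finite .of_finite, integral_add .of_finite .of_finite,
    integral_add .of_finite .of_finite,
    integral_const_mul, integral_const_mul, integral_const_mul]
  gcongr <;> exact integral_descFactorial_colCount_le ν _

theorem integral_bit_mul {i j : ι} (h : i ≠ j) :
    ∫ c : ι → Bool, bit c i * bit c j ∂Measure.pi (fun _ => ν) = ν.real {true} ^ 2 := by
  classical
  have := integral_prod_bit ν {i, j}
  simpa [Finset.prod_pair h, Finset.card_pair h] using this

theorem integral_bit_mul_mul {i j l : ι} (h : i ≠ j) (h' : i ≠ l) (h'' : j ≠ l) :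
    ∫ c : ι → Bool, bit c i * bit c j * bit c l ∂Measure.pi (fun _ => ν) = ν.real {true} ^ 3 := by
  classical
  have := integral_prod_bit ν {i, j, l}
  rw [Finset.card_insert_of_notMem (by simp [h, h']), Finset.card_pair h''] at this
  rw [← this]
  refine integral_congr_ae (.of_forall fun c => ?_)
  simp only
  rw [Finset.prod_insert (by simp [h, h']), Finset.prod_pair h'', mul_assoc]

theorem integral_bit_mul_mul_mul {i j l q : ι} (h : i ≠ j) (h' : i ≠ l) (h'' : j ≠ l)
    (h₁ : i ≠ q) (h₂ : j ≠ q) (h₃ : l ≠ q) :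
    ∫ c : ι → Bool, bit c i * bit c j * bit c l * bit c q ∂Measure.pi (fun _ => ν) =
      ν.real {true} ^ 4 := by
  classical
  have := integral_prod_bit ν {i, j, l, q}
  rw [Finset.card_insert_of_notMem (by simp [h, h', h₁]),
    Finset.card_insert_of_notMem (by simp [h'', h₂]), Finset.card_pair h₃] at this
  rw [← this]
  refine integral_congr_ae (.of_forall fun c => ?_)
  simp only
  rw [Finset.prod_insert (by simp [h, h', h₁]),
    Finset.prod_insert (by simp [h'', h₂]), Finset.prod_pair h₃]
  ring

variable [DecidableEq ι]

/-- The number of neighbours that the node `i` gets through the attribute with column `c`. -/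
def colDegree (i : ι) (c : ι → Bool) : ℝ := ∑ j ∈ Finset.univ.erase i, bit c i * bit c j

theorem colDegree_nonneg (i : ι) (c : ι → Bool) : 0 ≤ colDegree i c :=
  Finset.sum_nonneg fun _ _ => mul_nonneg (bit_nonneg _ _) (bit_nonneg _ _)

theorem colDegree_eq (i : ι) (c : ι → Bool) : colDegree i c = bit c i * (colCount c - 1) := by
  rw [colDegree, ← sum_bit, ← Finset.mul_sum, ← Finset.add_sum_erase _ _ (Finset.mem_univ i)]
  linear_combination - bit_mul_self c i

theorem sum_colDegree (c : ι → Bool) : ∑ i, colDegree i c = (colCount c).descFactorial 2 := by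
  simp_rw [colDegree_eq]
  rw [← Finset.sum_mul, sum_bit, cast_descFactorial_two]

theorem integral_colDegree (i : ι) :
    ∫ c, colDegree i c ∂Measure.pi (fun _ : ι => ν) =
      ((Fintype.card ι : ℝ) - 1) * ν.real {true} ^ 2 := by
  unfold colDegree
  rw [integral_finsetSum _ fun _ _ => Integrable.of_finite,
    Finset.sum_congr rfl fun j hj => integral_bit_mul ν (Finset.ne_of_mem_erase hj).symm,
    Finset.sum_const, Finset.card_erase_of_mem (Finset.mem_univ _), nsmul_eq_mul,
    Finset.card_univ, Nat.cast_sub (Fintype.card_pos_iff.2 ⟨i⟩), Nat.cast_one]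

theorem integral_colDegree_sq_le (i : ι) :
    ∫ c, colDegree i c ^ 2 ∂Measure.pi (fun _ : ι => ν) ≤
      Fintype.card ι * ν.real {true} ^ 2 + (Fintype.card ι) ^ 2 * ν.real {true} ^ 3 := by
  set p := ν.real {true}
  have hp : 0 ≤ p := measureReal_nonneg
  simp_rw [sq, colDegree, Finset.sum_mul_sum]
  rw [integral_finsetSum _ fun _ _ => Integrable.of_finite]
  -- Since bits are idempotent, only the number of distinct nodes matters: two when `j = l`, three
  -- otherwise.
  calc _ ≤ ∑ j ∈ Finset.univ.erase i, ∑ l ∈ Finset.univ.erase i,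
      ((if j = l then p ^ 2 else 0) + p ^ 3) := by
        refine Finset.sum_le_sum fun j hj => ?_
        rw [integral_finsetSum _ fun _ _ => Integrable.of_finite]
        refine Finset.sum_le_sum fun l hl => ?_
        have hj' := (Finset.ne_of_mem_erase hj).symm
        have hl' := (Finset.ne_of_mem_erase hl).symm
        by_cases h : j = l
        · subst h
          have : ∀ c : ι → Bool, bit c i * bit c j * (bit c i * bit c j) = bit c i * bit c j := by
            intro c
            linear_combination (bit c j * bit c j) * bit_mul_self c i + bit c i * bit_mul_self c j
          simp_rw [this, integral_bit_mul ν hj', if_true]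
          have : 0 ≤ p ^ 3 := by positivity
          linarith
        · have : ∀ c : ι → Bool, bit c i * bit c j * (bit c i * bit c l) =
              bit c i * bit c j * bit c l := by
            intro c
            linear_combination (bit c j * bit c l) * bit_mul_self c i
          simp_rw [this, integral_bit_mul_mul ν hj' hl' h, if_neg h]
          simp [p]
    _ ≤ ∑ j : ι, ∑ l : ι, ((if j = l then p ^ 2 else 0) + p ^ 3) := by
        have h0 : ∀ j l : ι, 0 ≤ (if j = l then p ^ 2 else 0) + p ^ 3 := by
          intro j l; split_ifs <;> positivity
        refine (Finset.sum_le_sum fun j _ => Finset.sum_le_sum_of_subset_of_nonneg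
          (Finset.erase_subset _ _) fun l _ _ => h0 j l).trans ?_
        exact Finset.sum_le_sum_of_subset_of_nonneg (Finset.erase_subset _ _)
          fun j _ _ => Finset.sum_nonneg fun l _ => h0 j l
    _ = _ := by
        simp [Finset.sum_add_distrib]
        ring

theorem integral_colDegree_mul_le {i i' : ι} (hi : i ≠ i') :
    ∫ c, colDegree i c * colDegree i' c ∂Measure.pi (fun _ : ι => ν) ≤
      ν.real {true} ^ 2 * (1 + Fintype.card ι * ν.real {true}) ^ 2 +
        Fintype.card ι * ν.real {true} ^ 3 := by
  set p := ν.real {true} with hpdef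
  have hp : 0 ≤ p := measureReal_nonneg
  simp_rw [colDegree, Finset.sum_mul_sum]
  rw [integral_finsetSum _ fun _ _ => Integrable.of_finite]
  -- This majorant covers every coincidence pattern of `i, j, i', l`. Its first part is a product of
  -- a function of `j` and a function of `l`, so that the double sum factorizes.
  have h0 : ∀ j l : ι, 0 ≤ p ^ 2 * (((if j = i' then 1 else 0) + p) * ((if l = i then 1 else 0) + p))
       + (if j = l then p ^ 3 else 0) := by
    intro j l; split_ifs <;> positivity
  calc _ ≤ ∑ j ∈ Finset.univ.erase i, ∑ l ∈ Finset.univ.erase i',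
      (p ^ 2 * (((if j = i' then 1 else 0) + p) * ((if l = i then 1 else 0) + p))
       + (if j = l then p ^ 3 else 0)) := by
        refine Finset.sum_le_sum fun j hj => ?_
        rw [integral_finsetSum _ fun _ _ => Integrable.of_finite]
        refine Finset.sum_le_sum fun l hl => ?_
        have hj' := (Finset.ne_of_mem_erase hj).symm
        have hl' := (Finset.ne_of_mem_erase hl).symm
        have e1 : 0 ≤ p ^ 3 := by positivity
        have e2 : 0 ≤ p ^ 4 := by positivity
        by_cases h1 : j = i' <;> by_cases h2 : l = i
        · subst h1 h2
          have : ∀ c : ι → Bool, bit c l * bit c j * (bit c j * bit c l) = bit c l * bit c j := by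
            intro c
            linear_combination (bit c j * bit c j) * bit_mul_self c l + bit c l * bit_mul_self c j
          simp_rw [this, integral_bit_mul ν hi, if_true, if_neg (Ne.symm hi), ← hpdef]
          nlinarith
        · subst h1
          have : ∀ c : ι → Bool, bit c i * bit c j * (bit c j * bit c l) =
              bit c i * bit c j * bit c l := by
            intro c
            linear_combination (bit c i * bit c l) * bit_mul_self c j
          simp_rw [this, integral_bit_mul_mul ν hi (Ne.symm h2) hl', if_true, if_neg h2,
            if_neg hl', ← hpdef]
          nlinarith
        · subst h2
          have : ∀ c : ι → Bool, bit c l * bit c j * (bit c i' * bit c l) =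
              bit c l * bit c j * bit c i' := by
            intro c
            linear_combination (bit c j * bit c i') * bit_mul_self c l
          simp_rw [this, integral_bit_mul_mul ν hj' hi h1, if_true, if_neg h1,
            if_neg hj'.symm, ← hpdef]
          nlinarith
        · by_cases h3 : j = l
          · subst h3
            have : ∀ c : ι → Bool, bit c i * bit c j * (bit c i' * bit c j) =
                bit c i * bit c i' * bit c j := by
              intro c
              linear_combination (bit c i * bit c i') * bit_mul_self c j
            simp_rw [this, integral_bit_mul_mul ν hi hj' hl', if_true, if_neg h1,
              if_neg hj'.symm, ← hpdef]
            nlinarith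
          · have : ∀ c : ι → Bool, bit c i * bit c j * (bit c i' * bit c l) =
                bit c i * bit c j * bit c i' * bit c l := fun c => by ring
            simp_rw [this, integral_bit_mul_mul_mul ν hj' hi h1 (Ne.symm h2) h3 hl', if_neg h1,
              if_neg h2, if_neg h3, ← hpdef]
            nlinarith
    _ ≤ ∑ j : ι, ∑ l : ι,
      (p ^ 2 * (((if j = i' then 1 else 0) + p) * ((if l = i then 1 else 0) + p))
       + (if j = l then p ^ 3 else 0)) := by
        refine (Finset.sum_le_sum fun j _ => Finset.sum_le_sum_of_subset_of_nonneg
          (Finset.erase_subset _ _) fun l _ _ => h0 j l).trans ?_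
        exact Finset.sum_le_sum_of_subset_of_nonneg (Finset.erase_subset _ _)
          fun j _ _ => Finset.sum_nonneg fun l _ => h0 j l
    _ = _ := by
        simp_rw [Finset.sum_add_distrib, ← Finset.mul_sum, ← Finset.sum_mul]
        simp only [Finset.sum_add_distrib, Finset.sum_ite_eq', Finset.sum_ite_eq, Finset.mem_univ,
          if_true, Finset.sum_const, Finset.card_univ, nsmul_eq_mul]
        ring

end Column

/-! ### Second moments of linear and quadratic sums over independent columns -/

section Pi

theorem sum_mul_sum_eq_diag_add_offDiag {κ : Type*} [Fintype κ] [DecidableEq κ] (a b : κ → ℝ) :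
    (∑ k, a k) * ∑ k, b k = ∑ k, a k * b k + ∑ q ∈ Finset.univ.offDiag, a q.1 * b q.2 := by
  rw [Finset.sum_mul_sum, ← Finset.sum_product', ← Finset.diag_union_offDiag,
    Finset.sum_union (Finset.disjoint_diag_offDiag _), Finset.sum_diag]

theorem card_offDiag_le {κ : Type*} [Fintype κ] [DecidableEq κ] :
    (((Finset.univ : Finset κ).offDiag.card : ℕ) : ℝ) ≤ (Fintype.card κ : ℝ) ^ 2 := by
  rw [Finset.offDiag_card, Finset.card_univ, sq]
  exact_mod_cast Nat.sub_le _ _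

variable {κ α : Type*} [Fintype κ] [MeasurableSpace α] (γ : Measure α) [IsProbabilityMeasure γ]

theorem integral_pi_mul_mul_mul (φ ψ χ ξ : α → ℝ) {k l q r : κ} (h : k ≠ l) (h' : k ≠ q)
    (h'' : l ≠ q) (h₁ : k ≠ r) (h₂ : l ≠ r) (h₃ : q ≠ r) :
    ∫ ω : κ → α, φ (ω k) * ψ (ω l) * χ (ω q) * ξ (ω r) ∂Measure.pi (fun _ => γ) =
      (∫ a, φ a ∂γ) * (∫ a, ψ a ∂γ) * (∫ a, χ a ∂γ) * ∫ a, ξ a ∂γ := by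
  classical
  have := integral_pi_finsetProd γ
    (fun s => if s = k then φ else if s = l then ψ else if s = q then χ else ξ) {k, l, q, r}
  have e : ∀ F : κ → ℝ, ∏ i ∈ ({k, l, q, r} : Finset κ), F i = F k * F l * F q * F r := by
    intro F
    rw [Finset.prod_insert (by simp [h, h', h₁]), Finset.prod_insert (by simp [h'', h₂]),
      Finset.prod_pair h₃]
    ring
  simpa [e, h.symm, h'.symm, h''.symm, h₁.symm, h₂.symm, h₃.symm] using this

/-- Unless the pairs `{k, l}` and `{k', l'}` coincide, some factor `g` sits at an index of its own
and integrates to 0; centering of `g` alone is enough. -/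
theorem integral_pi_four_centered {f g : α → ℝ}
    (hg : ∫ a, g a ∂γ = 0) {k l k' l' : κ} (h : k ≠ l) (h' : k' ≠ l') [DecidableEq κ] :
    ∫ ω : κ → α, (f (ω k) * f (ω l)) * (g (ω k') * g (ω l')) ∂Measure.pi (fun _ => γ) =
      if (k' = k ∧ l' = l) ∨ (k' = l ∧ l' = k) then (∫ a, f a * g a ∂γ) ^ 2 else 0 := by
  by_cases h1 : k' = k
  · subst h1
    by_cases h2 : l' = l
    · subst h2
      rw [if_pos (by simp), sq, ← integral_pi_mul γ (fun a => f a * g a) (fun a => f a * g a) h]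
      exact integral_congr_ae (.of_forall fun ω => by simp only; ring)
    · rw [if_neg (by simp [h2, h]), ← mul_zero ((∫ a, f a * g a ∂γ) * ∫ a, f a ∂γ), ← hg,
        ← integral_pi_mul_mul γ (fun a => f a * g a) f g h h' (Ne.symm h2)]
      exact integral_congr_ae (.of_forall fun ω => by simp only; ring)
  by_cases h3 : l' = k
  · subst h3
    by_cases h2 : k' = l
    · subst h2
      rw [if_pos (by simp), sq, ← integral_pi_mul γ (fun a => f a * g a) (fun a => f a * g a) h]
      exact integral_congr_ae (.of_forall fun ω => by simp only; ring)
    · rw [if_neg (by simp [h2, h1]), ← mul_zero ((∫ a, f a * g a ∂γ) * ∫ a, f a ∂γ), ← hg,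
        ← integral_pi_mul_mul γ (fun a => f a * g a) f g h (Ne.symm h1) (Ne.symm h2)]
      exact integral_congr_ae (.of_forall fun ω => by simp only; ring)
  rw [if_neg (by simp [h1, h3])]
  by_cases h4 : k' = l
  · subst h4
    rw [← mul_zero ((∫ a, f a ∂γ) * ∫ a, f a * g a ∂γ), ← hg,
      ← integral_pi_mul_mul γ f (fun a => f a * g a) g h (Ne.symm h3) h']
    exact integral_congr_ae (.of_forall fun ω => by simp only; ring)
  by_cases h5 : l' = l
  · subst h5
    rw [← mul_zero ((∫ a, f a ∂γ) * ∫ a, f a * g a ∂γ), ← hg,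
      ← integral_pi_mul_mul γ f (fun a => f a * g a) g h (Ne.symm h1) (Ne.symm h4)]
    exact integral_congr_ae (.of_forall fun ω => by simp only; ring)
  rw [← mul_zero ((∫ a, f a ∂γ) * (∫ a, f a ∂γ) * ∫ a, g a ∂γ), ← hg,
    ← integral_pi_mul_mul_mul γ f f g g h (Ne.symm h1) (Ne.symm h4) (Ne.symm h3) (Ne.symm h5) h']
  exact integral_congr_ae (.of_forall fun ω => by simp only; ring)

variable [Finite α] [MeasurableSingletonClass α]

theorem integral_pi_sum (φ : α → ℝ) :
    ∫ ω : κ → α, ∑ k, φ (ω k) ∂Measure.pi (fun _ => γ) = Fintype.card κ * ∫ a, φ a ∂γ := by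
  rw [integral_finsetSum _ fun _ _ => Integrable.of_finite]
  simp [integral_pi_eval γ]

theorem integral_sub_integral_mul (φ ψ : α → ℝ) :
    ∫ a, (φ a - ∫ b, φ b ∂γ) * (ψ a - ∫ b, ψ b ∂γ) ∂γ =
      ∫ a, φ a * ψ a ∂γ - (∫ b, φ b ∂γ) * ∫ b, ψ b ∂γ := by
  set x := ∫ b, φ b ∂γ
  set y := ∫ b, ψ b ∂γ
  have : ∀ a, (φ a - x) * (ψ a - y) = φ a * ψ a - y * φ a - x * ψ a + x * y := fun a => by ring
  simp_rw [this]
  rw [integral_add .of_finite .of_finite, integral_sub .of_finite .of_finite,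
    integral_sub .of_finite .of_finite, integral_const_mul, integral_const_mul, integral_const]
  simp
  ring

theorem integral_sub_integral_eq_zero (φ : α → ℝ) : ∫ a, (φ a - ∫ b, φ b ∂γ) ∂γ = 0 := by
  rw [integral_sub .of_finite .of_finite]; simp

/-- The variance of an i.i.d. sum, with the variance of one term bounded by its second moment. -/
theorem integral_pi_sum_sub_sq_le (φ : α → ℝ) :
    ∫ ω : κ → α, (∑ k, φ (ω k) - Fintype.card κ * ∫ a, φ a ∂γ) ^ 2 ∂Measure.pi (fun _ => γ) ≤
      Fintype.card κ * ∫ a, φ a ^ 2 ∂γ := by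
  classical
  set e := ∫ a, φ a ∂γ with he
  set h : α → ℝ := fun a => φ a - e with hh
  have h0 : ∫ a, h a ∂γ = 0 := integral_sub_integral_eq_zero γ φ
  have h1 : ∀ ω : κ → α, (∑ k, φ (ω k) - Fintype.card κ * e) ^ 2 =
      ∑ k, h (ω k) * h (ω k) + ∑ q ∈ Finset.univ.offDiag, h (ω q.1) * h (ω q.2) := by
    intro ω
    rw [← sum_mul_sum_eq_diag_add_offDiag (fun k => h (ω k)) fun k => h (ω k), ← sq]
    simp [hh]
  simp_rw [h1]
  rw [integral_add .of_finite .of_finite, integral_pi_sum γ fun a => h a * h a,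
    integral_finsetSum _ fun _ _ => Integrable.of_finite, Finset.sum_eq_zero (s := Finset.offDiag _),
    add_zero]
  · refine mul_le_mul_of_nonneg_left ?_ (Nat.cast_nonneg _)
    have := integral_sub_integral_mul γ φ φ
    simp_rw [sq]
    linarith [mul_self_nonneg (∫ b, φ b ∂γ)]
  · intro q hq
    rw [integral_pi_mul γ h h (Finset.mem_offDiag.1 hq).2.2, h0, zero_mul]

/-- In the expanded square, a pair `q` correlates only with `r = q` and `r = q.swap`, which explains
the factor 2. Keeping the sum over `i` inside the square retains the smallness of the covariances
for `i ≠ j`. -/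
theorem integral_pi_sum_offDiag_sq_le {ι : Type*} [Fintype ι] [DecidableEq κ] (h : ι → α → ℝ)
    (h0 : ∀ i, ∫ a, h i a ∂γ = 0) :
    ∫ ω : κ → α, (∑ i, ∑ q ∈ Finset.univ.offDiag, h i (ω q.1) * h i (ω q.2)) ^ 2
      ∂Measure.pi (fun _ => γ) ≤
      2 * (Fintype.card κ : ℝ) ^ 2 * ∑ i, ∑ j, (∫ a, h i a * h j a ∂γ) ^ 2 := by
  simp_rw [sq (∑ i, ∑ q ∈ Finset.univ.offDiag, h i (_ : α) * h i _), Finset.sum_mul_sum]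
  rw [integral_finsetSum _ fun _ _ => Integrable.of_finite, Finset.mul_sum]
  refine Finset.sum_le_sum fun i _ => ?_
  rw [integral_finsetSum _ fun _ _ => Integrable.of_finite, Finset.mul_sum]
  refine Finset.sum_le_sum fun j _ => ?_
  rw [integral_finsetSum _ fun _ _ => Integrable.of_finite]
  set v := (∫ a, h i a * h j a ∂γ) ^ 2 with hv
  have hv0 : 0 ≤ v := sq_nonneg _
  calc _ ≤ ∑ _q ∈ (Finset.univ : Finset κ).offDiag, 2 * v := by
        refine Finset.sum_le_sum fun q hq => ?_
        rw [integral_finsetSum _ fun _ _ => Integrable.of_finite]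
        calc _ ≤ ∑ r ∈ (Finset.univ : Finset κ).offDiag,
            ((if r = q then v else 0) + if r = q.swap then v else 0) := by
              refine Finset.sum_le_sum fun r hr => ?_
              rw [integral_pi_four_centered γ (h0 j) (Finset.mem_offDiag.1 hq).2.2
                (Finset.mem_offDiag.1 hr).2.2, ← hv]
              simp only [Prod.ext_iff, Prod.fst_swap, Prod.snd_swap]
              split_ifs <;> first | linarith | (exfalso; tauto)
          _ ≤ 2 * v := by
              rw [Finset.sum_add_distrib, Finset.sum_ite_eq', Finset.sum_ite_eq']
              split_ifs <;> linarith
    _ ≤ _ := by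
        rw [Finset.sum_const, nsmul_eq_mul]
        nlinarith [card_offDiag_le (κ := κ)]

end Pi

/-! ### Expected numbers of coincidences between attributes -/

section Matrix

variable {κ ι : Type*} [Fintype κ] [DecidableEq κ]

/-- The number of common attributes of two nodes. -/
def commonCount (i j : ι) (ω : κ → ι → Bool) : ℝ := ∑ k, bit (ω k) i * bit (ω k) j

/-- The number of attributes common to three nodes. -/
def commonCount₃ (i j l : ι) (ω : κ → ι → Bool) : ℝ := ∑ k, bit (ω k) i * bit (ω k) j * bit (ω k) l

/-- The number of ways to connect three nodes pairwise through three distinct attributes. -/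
def rainbowCount (i j l : ι) (ω : κ → ι → Bool) : ℝ :=
  ∑ q ∈ Finset.univ.offDiag, ∑ r ∈ Finset.univ.filter fun r => q.1 ≠ r ∧ q.2 ≠ r,
    (bit (ω q.1) i * bit (ω q.1) j) * (bit (ω q.2) j * bit (ω q.2) l) *
      (bit (ω r) i * bit (ω r) l)

/-- The diagonal part of the square of a sum of 0-1 terms is the sum itself, so what remains counts
ordered pairs of different common attributes. -/
theorem commonCount_mul_sub_one (i j : ι) (ω : κ → ι → Bool) :
    commonCount i j ω * (commonCount i j ω - 1) =
      ∑ q ∈ Finset.univ.offDiag, (bit (ω q.1) i * bit (ω q.1) j) *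
        (bit (ω q.2) i * bit (ω q.2) j) := by
  have h := sum_mul_sum_eq_diag_add_offDiag (fun k => bit (ω k) i * bit (ω k) j)
    fun k => bit (ω k) i * bit (ω k) j
  have h2 : ∀ k, bit (ω k) i * bit (ω k) j * (bit (ω k) i * bit (ω k) j) =
      bit (ω k) i * bit (ω k) j := fun k => by
    linear_combination (bit (ω k) j * bit (ω k) j) * bit_mul_self (ω k) i
      + bit (ω k) i * bit_mul_self (ω k) j
  simp_rw [h2] at h
  unfold commonCount
  linarith

variable [Fintype ι] (ν : Measure Bool) [IsProbabilityMeasure ν]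

theorem integral_commonCount_mul_sub_one_le {i j : ι} (h : i ≠ j) :
    ∫ ω : κ → ι → Bool, commonCount i j ω * (commonCount i j ω - 1)
      ∂Measure.pi (fun _ => Measure.pi fun _ => ν) ≤
      (Fintype.card κ : ℝ) ^ 2 * ν.real {true} ^ 4 := by
  simp_rw [commonCount_mul_sub_one]
  rw [integral_finsetSum _ fun _ _ => Integrable.of_finite,
    Finset.sum_congr rfl (g := fun _ => ν.real {true} ^ 4)]
  · rw [Finset.sum_const, nsmul_eq_mul]
    gcongr
    exact card_offDiag_le
  · intro q hq
    rw [integral_pi_mul (Measure.pi fun _ : ι => ν) (fun c => bit c i * bit c j)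
      (fun c => bit c i * bit c j) (Finset.mem_offDiag.1 hq).2.2, integral_bit_mul ν h]
    ring

theorem integral_commonCount_mul_sub_one_mul_le {i j l : ι} (h : i ≠ j) (h' : i ≠ l)
    (h'' : j ≠ l) :
    ∫ ω : κ → ι → Bool, commonCount i j ω * (commonCount i j ω - 1) * commonCount i l ω
      ∂Measure.pi (fun _ => Measure.pi fun _ => ν) ≤
      (Fintype.card κ : ℝ) ^ 2 * (2 * ν.real {true} ^ 5 + Fintype.card κ * ν.real {true} ^ 6) := by
  set p := ν.real {true} with hpdef
  have hp : 0 ≤ p := measureReal_nonneg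
  simp_rw [commonCount_mul_sub_one, commonCount, Finset.sum_mul_sum]
  rw [integral_finsetSum _ fun _ _ => Integrable.of_finite]
  calc _ ≤ ∑ q ∈ (Finset.univ : Finset κ).offDiag, (2 * p ^ 5 + Fintype.card κ * p ^ 6) := by
        refine Finset.sum_le_sum fun q hq => ?_
        have hq' := (Finset.mem_offDiag.1 hq).2.2
        rw [integral_finsetSum _ fun _ _ => Integrable.of_finite]
        -- If the attribute linking `i` to `l` is one of the two linking `i` to `j`, one matrix
        -- entry is shared and five independent entries remain; otherwise there are six.
        calc _ ≤ ∑ r : κ, ((if r = q.1 then p ^ 5 else 0) + (if r = q.2 then p ^ 5 else 0)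
            + p ^ 6) := by
              refine Finset.sum_le_sum fun r _ => ?_
              have e1 : 0 ≤ p ^ 6 := by positivity
              by_cases h1 : r = q.1
              · rw [if_pos h1, h1, if_neg hq']
                have := integral_pi_mul (Measure.pi fun _ : ι => ν)
                  (fun c => bit c i * bit c j * bit c l) (fun c => bit c i * bit c j) hq'
                rw [integral_bit_mul_mul ν h h' h'', integral_bit_mul ν h] at this
                calc _ = p ^ 3 * p ^ 2 := by
                      rw [← this]
                      refine integral_congr_ae (.of_forall fun ω => ?_)
                      linear_combination (bit (ω q.1) j * bit (ω q.2) i * bit (ω q.2) j *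
                        bit (ω q.1) l) * bit_mul_self (ω q.1) i
                  _ ≤ _ := by linarith
              by_cases h2 : r = q.2
              · rw [if_pos h2, h2, if_neg hq'.symm]
                have := integral_pi_mul (Measure.pi fun _ : ι => ν)
                  (fun c => bit c i * bit c j) (fun c => bit c i * bit c j * bit c l) hq'
                rw [integral_bit_mul_mul ν h h' h'', integral_bit_mul ν h] at this
                calc _ = p ^ 2 * p ^ 3 := by
                      rw [← this]
                      refine integral_congr_ae (.of_forall fun ω => ?_)
                      linear_combination (bit (ω q.1) j * bit (ω q.1) i * bit (ω q.2) j *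
                        bit (ω q.2) l) * bit_mul_self (ω q.2) i
                  _ ≤ _ := by linarith
              · rw [integral_pi_mul_mul (Measure.pi fun _ : ι => ν) (fun c => bit c i * bit c j)
                  (fun c => bit c i * bit c j) (fun c => bit c i * bit c l) hq' (Ne.symm h1)
                  (Ne.symm h2), integral_bit_mul ν h, integral_bit_mul ν h', if_neg h1, if_neg h2,
                  ← hpdef]
                apply le_of_eq; ring
          _ = _ := by
              simp only [Finset.sum_add_distrib, Finset.sum_ite_eq', Finset.mem_univ,
                if_true, Finset.sum_const, Finset.card_univ, nsmul_eq_mul]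
              ring
    _ ≤ _ := by
        rw [Finset.sum_const, nsmul_eq_mul]
        gcongr
        exact card_offDiag_le

theorem integral_rainbowCount_le {i j l : ι} (h : i ≠ j) (h' : i ≠ l) (h'' : j ≠ l) :
    ∫ ω : κ → ι → Bool, rainbowCount i j l ω ∂Measure.pi (fun _ => Measure.pi fun _ => ν) ≤
      (Fintype.card κ : ℝ) ^ 3 * ν.real {true} ^ 6 := by
  unfold rainbowCount
  rw [integral_finsetSum _ fun _ _ => Integrable.of_finite]
  calc _ ≤ ∑ q ∈ (Finset.univ : Finset κ).offDiag, Fintype.card κ * ν.real {true} ^ 6 := by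
        refine Finset.sum_le_sum fun q hq => ?_
        have hq' := (Finset.mem_offDiag.1 hq).2.2
        rw [integral_finsetSum _ fun _ _ => Integrable.of_finite,
          Finset.sum_congr rfl (g := fun _ => ν.real {true} ^ 6)]
        · rw [Finset.sum_const, nsmul_eq_mul]
          gcongr
          exact Finset.card_le_univ _
        · intro r hr
          have hr' := (Finset.mem_filter.1 hr).2
          rw [integral_pi_mul_mul (Measure.pi fun _ : ι => ν) (fun c => bit c i * bit c j)
            (fun c => bit c j * bit c l) (fun c => bit c i * bit c l) hq' hr'.1 hr'.2,
            integral_bit_mul ν h, integral_bit_mul ν h', integral_bit_mul ν h'']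
          ring
    _ ≤ _ := by
        rw [Finset.sum_const, nsmul_eq_mul, pow_succ (Fintype.card κ : ℝ), mul_assoc]
        gcongr
        exact card_offDiag_le

end Matrix

/-! ### Pathwise comparison of subgraph counts with polynomials in the matrix entries -/

section Matrix

theorem abs_sum_sub_sum_le {β : Type*} (s : Finset β) (f g h : β → ℝ)
    (H : ∀ b ∈ s, |f b - g b| ≤ h b) : |∑ b ∈ s, f b - ∑ b ∈ s, g b| ≤ ∑ b ∈ s, h b := by
  rw [← Finset.sum_sub_distrib]
  exact (Finset.abs_sum_le_sum_abs _ _).trans (Finset.sum_le_sum H)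

variable {κ ι : Type*}

/-- The intersection graph of a Boolean matrix with one column for each attribute. -/
def attrGraph (ω : κ → ι → Bool) : SimpleGraph ι where
  Adj i j := i ≠ j ∧ ∃ k, ω k i = true ∧ ω k j = true
  symm := ⟨fun _ _ h => ⟨h.1.symm, h.2.imp fun _ h => h.symm⟩⟩
  loopless := ⟨fun _ h => h.1 rfl⟩

/-- The indicator that two nodes have a common attribute. -/
noncomputable def link (ω : κ → ι → Bool) (i j : ι) : ℝ :=
  open Classical in if ∃ k, ω k i = true ∧ ω k j = true then 1 else 0

/-- The sum over ordered triples of distinct nodes. -/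
def tripleSum [Fintype ι] [DecidableEq ι] (f : ι → ι → ι → ℝ) : ℝ :=
  ∑ i, ∑ j, ∑ l, if i ≠ j ∧ i ≠ l ∧ j ≠ l then f i j l else 0

/-- The sum over ordered pairs of distinct nodes. -/
def pairSum [Fintype ι] [DecidableEq ι] (f : ι → ι → ℝ) : ℝ :=
  ∑ i, ∑ j, if i ≠ j then f i j else 0

/-- The gap between 0 and 1 is the only integrality of `commonCount` that the comparison bounds
below need. -/
theorem link_cases [Fintype κ] (ω : κ → ι → Bool) (i j : ι) :
    (commonCount i j ω = 0 ∧ link ω i j = 0) ∨ (1 ≤ commonCount i j ω ∧ link ω i j = 1) := by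
  by_cases h : ∃ k, ω k i = true ∧ ω k j = true
  · right
    refine ⟨?_, by simp only [link]; rw [if_pos h]⟩
    obtain ⟨k, h1, h2⟩ := h
    calc (1 : ℝ) = bit (ω k) i * bit (ω k) j := by simp [bit, h1, h2]
      _ ≤ _ := Finset.single_le_sum (f := fun k => bit (ω k) i * bit (ω k) j)
        (fun k _ => mul_nonneg (bit_nonneg _ _) (bit_nonneg _ _)) (Finset.mem_univ k)
  · left
    refine ⟨Finset.sum_eq_zero fun k _ => ?_, by simp only [link]; rw [if_neg h]⟩
    push Not at h
    have := h k
    unfold bit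
    split_ifs <;> simp_all

theorem abs_link_sub_le [Fintype κ] (ω : κ → ι → Bool) (i j : ι) :
    |link ω i j - commonCount i j ω| ≤ commonCount i j ω * (commonCount i j ω - 1) := by
  rcases link_cases ω i j with ⟨h1, h2⟩ | ⟨h1, h2⟩
  · simp [h1, h2]
  · rw [h2, abs_sub_comm, abs_of_nonneg (by linarith)]
    nlinarith

theorem abs_link_mul_link_sub_le [Fintype κ] (ω : κ → ι → Bool) (i j l : ι) :
    |link ω i j * link ω i l - commonCount i j ω * commonCount i l ω| ≤
      commonCount i j ω * (commonCount i j ω - 1) * commonCount i l ω +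
        commonCount i l ω * (commonCount i l ω - 1) * commonCount i j ω := by
  rcases link_cases ω i j with ⟨h1, h2⟩ | ⟨h1, h2⟩
  · simp [h1, h2]
  rcases link_cases ω i l with ⟨h3, h4⟩ | ⟨h3, h4⟩
  · simp [h3, h4]
  rw [h2, h4, abs_sub_comm, abs_of_nonneg (by nlinarith)]
  nlinarith [mul_nonneg (sub_nonneg.2 h1) (sub_nonneg.2 h3),
    mul_nonneg (mul_nonneg (sub_nonneg.2 h1) (sub_nonneg.2 h3)) (sub_nonneg.2 h1),
    mul_nonneg (mul_nonneg (sub_nonneg.2 h1) (sub_nonneg.2 h3)) (sub_nonneg.2 h3)]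

theorem rainbowTerm_nonneg (ω : κ → ι → Bool) (i j l : ι) (k q r : κ) :
    0 ≤ (bit (ω k) i * bit (ω k) j) * (bit (ω q) j * bit (ω q) l) *
      (bit (ω r) i * bit (ω r) l) :=
  mul_nonneg (mul_nonneg (mul_nonneg (bit_nonneg _ _) (bit_nonneg _ _))
    (mul_nonneg (bit_nonneg _ _) (bit_nonneg _ _))) (mul_nonneg (bit_nonneg _ _) (bit_nonneg _ _))

theorem rainbowCount_nonneg [Fintype κ] [DecidableEq κ] (ω : κ → ι → Bool) (i j l : ι) :
    0 ≤ rainbowCount i j l ω :=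
  Finset.sum_nonneg fun _ _ => Finset.sum_nonneg fun _ _ => rainbowTerm_nonneg _ _ _ _ _ _ _

theorem one_le_rainbowCount [Fintype κ] [DecidableEq κ] (ω : κ → ι → Bool) {i j l : ι}
    {k q r : κ} (hkq : k ≠ q) (hkr : k ≠ r) (hqr : q ≠ r) (hki : ω k i = true)
    (hkj : ω k j = true) (hqj : ω q j = true) (hql : ω q l = true) (hri : ω r i = true)
    (hrl : ω r l = true) : 1 ≤ rainbowCount i j l ω := by
  have hkq' : (k, q) ∈ (Finset.univ : Finset κ).offDiag :=
    Finset.mem_offDiag.2 ⟨Finset.mem_univ k, Finset.mem_univ q, hkq⟩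
  have h1 : (bit (ω k) i * bit (ω k) j) * (bit (ω q) j * bit (ω q) l) *
      (bit (ω r) i * bit (ω r) l) = 1 := by simp [bit, hki, hkj, hri, hrl, hqj, hql]
  rw [← h1]
  refine le_trans ?_ (Finset.single_le_sum
    (fun s _ => Finset.sum_nonneg fun t _ => rainbowTerm_nonneg ω i j l s.1 s.2 t)
    hkq')
  exact Finset.single_le_sum (f := fun t => (bit (ω k) i * bit (ω k) j) *
    (bit (ω q) j * bit (ω q) l) * (bit (ω t) i * bit (ω t) l))
    (fun t _ => rainbowTerm_nonneg ω i j l k q t)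
    (Finset.mem_filter.2 ⟨Finset.mem_univ r, hkr, hqr⟩)

/-- If some attribute is shared by all three nodes, the excess of `commonCount₃` over 1 is at most
that of `commonCount i j`. If none is, a triangle needs three pairwise different attributes and
`rainbowCount` is at least 1. -/
theorem abs_link_mul_link_mul_link_sub_le [Fintype κ] [DecidableEq κ] (ω : κ → ι → Bool)
    (i j l : ι) :
    |link ω i j * link ω i l * link ω j l - commonCount₃ i j l ω| ≤
      commonCount i j ω * (commonCount i j ω - 1) * commonCount i l ω + rainbowCount i j l ω := by
  have hR := rainbowCount_nonneg ω i j l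
  have hW : 0 ≤ commonCount i j ω * (commonCount i j ω - 1) * commonCount i l ω := by
    rcases link_cases ω i j with ⟨h1, h2⟩ | ⟨h1, h2⟩
    · simp [h1]
    rcases link_cases ω i l with ⟨h3, h4⟩ | ⟨h3, h4⟩
    · simp [h3]
    · exact mul_nonneg (mul_nonneg (by linarith) (by linarith)) (by linarith)
  by_cases hT : ∃ k, ω k i = true ∧ ω k j = true ∧ ω k l = true
  · obtain ⟨k, h1, h2, h3⟩ := hT
    have hone : link ω i j * link ω i l * link ω j l = 1 := by
      simp only [link]
      rw [if_pos ⟨k, h1, h2⟩, if_pos ⟨k, h1, h3⟩, if_pos ⟨k, h2, h3⟩]; norm_num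
    have hge : 1 ≤ commonCount₃ i j l ω := by
      calc (1 : ℝ) = bit (ω k) i * bit (ω k) j * bit (ω k) l := by simp [bit, h1, h2, h3]
        _ ≤ _ := Finset.single_le_sum (f := fun k => bit (ω k) i * bit (ω k) j * bit (ω k) l)
          (fun k _ => mul_nonneg (mul_nonneg (bit_nonneg _ _) (bit_nonneg _ _)) (bit_nonneg _ _))
          (Finset.mem_univ k)
    have hle : commonCount₃ i j l ω ≤ commonCount i j ω :=
      Finset.sum_le_sum fun k _ => mul_le_of_le_one_right
        (mul_nonneg (bit_nonneg _ _) (bit_nonneg _ _)) (bit_le_one _ _)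
    have hil : 1 ≤ commonCount i l ω := by
      rcases link_cases ω i l with ⟨h3, h4⟩ | ⟨h3, h4⟩
      · simp [h4] at hone
      · exact h3
    rw [hone, abs_sub_comm, abs_of_nonneg (by linarith)]
    have a1 : commonCount i j ω - 1 ≤ commonCount i j ω * (commonCount i j ω - 1) := by nlinarith
    have a2 : commonCount i j ω * (commonCount i j ω - 1) ≤
        commonCount i j ω * (commonCount i j ω - 1) * commonCount i l ω :=
      le_mul_of_one_le_right (mul_nonneg (by linarith) (by linarith)) hil
    linarith
  · push Not at hT
    have h0 : commonCount₃ i j l ω = 0 := Finset.sum_eq_zero fun k _ => by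
      have := hT k
      unfold bit
      split_ifs <;> simp_all
    rw [h0, sub_zero]
    by_cases h1 : ∃ k, ω k i = true ∧ ω k j = true
    swap
    · simp only [link, if_neg h1]; simp only [zero_mul, abs_zero]; linarith
    by_cases h2 : ∃ k, ω k i = true ∧ ω k l = true
    swap
    · simp only [link, if_neg h2]; simp only [mul_zero, zero_mul, abs_zero]; linarith
    by_cases h3 : ∃ k, ω k j = true ∧ ω k l = true
    swap
    · simp only [link, if_neg h3]; simp only [mul_zero, abs_zero]; linarith
    simp only [link, if_pos h1, if_pos h2, if_pos h3, mul_one, abs_one]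
    obtain ⟨k, hki, hkj⟩ := h1
    obtain ⟨r, hri, hrl⟩ := h2
    obtain ⟨q, hqj, hql⟩ := h3
    have := one_le_rainbowCount ω (by rintro rfl; exact hT _ hki hkj hql)
      (by rintro rfl; exact hT _ hki hkj hrl) (by rintro rfl; exact hT _ hri hqj hql)
      hki hkj hqj hql hri hrl
    linarith

variable [Fintype ι] [DecidableEq ι]

theorem two_mul_numEdges_attrGraph (ω : κ → ι → Bool) :
    2 * (numEdges (attrGraph ω) : ℝ) = pairSum fun i j => link ω i j := by
  classical
  rw [SimpleGraph.two_mul_numEdges, pairSum]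
  refine Finset.sum_congr rfl fun i _ => Finset.sum_congr rfl fun j _ => ?_
  simp only [link, attrGraph]
  by_cases h1 : ∃ k, ω k i = true ∧ ω k j = true <;> by_cases h2 : i = j <;> simp [h1, h2]

theorem two_mul_numTwoStars_attrGraph (ω : κ → ι → Bool) :
    2 * (numTwoStars (attrGraph ω) : ℝ) = tripleSum fun i j l => link ω i j * link ω i l := by
  classical
  rw [SimpleGraph.two_mul_numTwoStars, tripleSum]
  refine Finset.sum_congr rfl fun i _ => Finset.sum_congr rfl fun j _ =>
    Finset.sum_congr rfl fun l _ => ?_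
  simp only [link, attrGraph]
  by_cases h1 : ∃ k, ω k i = true ∧ ω k j = true <;>
  by_cases h2 : ∃ k, ω k i = true ∧ ω k l = true <;>
  simp only [h1, h2, if_true, if_false, and_true, and_false, false_and,
    mul_one, mul_zero, ite_self]
  split_ifs <;> first | rfl | tauto

theorem six_mul_numTriangles_attrGraph (ω : κ → ι → Bool) :
    6 * (numTriangles (attrGraph ω) : ℝ) =
      tripleSum fun i j l => link ω i j * link ω i l * link ω j l := by
  classical
  rw [SimpleGraph.six_mul_numTriangles, tripleSum]
  refine Finset.sum_congr rfl fun i _ => Finset.sum_congr rfl fun j _ =>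
    Finset.sum_congr rfl fun l _ => ?_
  simp only [link, attrGraph]
  by_cases h1 : ∃ k, ω k i = true ∧ ω k j = true <;>
  by_cases h2 : ∃ k, ω k i = true ∧ ω k l = true <;>
  by_cases h3 : ∃ k, ω k j = true ∧ ω k l = true <;>
  simp only [h1, h2, h3, if_true, if_false, and_true, and_false, false_and,
    mul_one, mul_zero, ite_self]
  split_ifs <;> first | rfl | tauto

theorem abs_pairSum_sub_le {f g h : ι → ι → ℝ} (H : ∀ i j, |f i j - g i j| ≤ h i j) :
    |pairSum f - pairSum g| ≤ pairSum h := by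
  refine abs_sum_sub_sum_le _ _ _ _ fun i _ => abs_sum_sub_sum_le _ _ _ _ fun j _ => ?_
  split_ifs
  · exact H i j
  · simp

theorem abs_tripleSum_sub_le {f g h : ι → ι → ι → ℝ} (H : ∀ i j l, |f i j l - g i j l| ≤ h i j l) :
    |tripleSum f - tripleSum g| ≤ tripleSum h := by
  refine abs_sum_sub_sum_le _ _ _ _ fun i _ => abs_sum_sub_sum_le _ _ _ _ fun j _ =>
    abs_sum_sub_sum_le _ _ _ _ fun l _ => ?_
  split_ifs
  · exact H i j l
  · simp

theorem sum_ite_ne (f : ι → ℝ) (i : ι) : (∑ j, if i ≠ j then f j else 0) = ∑ j, f j - f i := by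
  have : ∀ j, (if i ≠ j then f j else 0) = f j - if i = j then f j else 0 := by
    intro j; split_ifs <;> simp_all
  simp [this]

theorem pairSum_bit (c : ι → Bool) :
    (pairSum fun i j => bit c i * bit c j) = (colCount c).descFactorial 2 := by
  simp_rw [pairSum, sum_ite_ne fun j => bit c _ * bit c j]
  rw [cast_descFactorial_two, Finset.sum_sub_distrib, ← Finset.sum_mul_sum, sum_bit]
  simp_rw [bit_mul_self]
  rw [sum_bit]
  ring

theorem tripleSum_bit (c : ι → Bool) :
    (tripleSum fun i j l => bit c i * bit c j * bit c l) = (colCount c).descFactorial 3 := by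
  have h : ∀ i j, (∑ l, if i ≠ j ∧ i ≠ l ∧ j ≠ l then bit c i * bit c j * bit c l else 0) =
      (if i ≠ j then bit c i * bit c j else 0) * (colCount c - 2) := by
    intro i j
    by_cases hij : i = j
    · simp [hij]
    · have : ∀ l, (if i ≠ j ∧ i ≠ l ∧ j ≠ l then bit c i * bit c j * bit c l else 0) =
          bit c i * bit c j * bit c l - (if i = l then bit c i * bit c j * bit c l else 0) -
            if j = l then bit c i * bit c j * bit c l else 0 := by
        intro l
        split_ifs <;> simp_all
      simp_rw [this, Finset.sum_sub_distrib, Finset.sum_ite_eq, ← Finset.mul_sum, sum_bit]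
      simp only [Finset.mem_univ, if_true, ne_eq, hij, not_false_eq_true]
      linear_combination (-bit c j) * bit_mul_self c i - bit c i * bit_mul_self c j
  have h2 := pairSum_bit c
  unfold pairSum at h2
  simp_rw [tripleSum, h, ← Finset.sum_mul, h2]
  rw [cast_descFactorial_two, cast_descFactorial_three]

variable [Fintype κ]

theorem pairSum_sum (f : κ → ι → ι → ℝ) :
    (pairSum fun i j => ∑ k, f k i j) = ∑ k, pairSum (f k) := by
  refine (Finset.sum_comm.trans (Finset.sum_congr rfl fun i _ => Finset.sum_comm.trans
    (Finset.sum_congr rfl fun j _ => ?_))).symm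
  split_ifs <;> simp

theorem tripleSum_sum (f : κ → ι → ι → ι → ℝ) :
    (tripleSum fun i j l => ∑ k, f k i j l) = ∑ k, tripleSum (f k) := by
  refine (Finset.sum_comm.trans (Finset.sum_congr rfl fun i _ => Finset.sum_comm.trans
    (Finset.sum_congr rfl fun j _ => Finset.sum_comm.trans
    (Finset.sum_congr rfl fun l _ => ?_)))).symm
  split_ifs <;> simp

theorem pairSum_commonCount (ω : κ → ι → Bool) :
    (pairSum fun i j => commonCount i j ω) = ∑ k, ((colCount (ω k)).descFactorial 2 : ℝ) := by
  simp_rw [← pairSum_bit]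
  exact pairSum_sum _

theorem tripleSum_commonCount₃ (ω : κ → ι → Bool) :
    (tripleSum fun i j l => commonCount₃ i j l ω) =
      ∑ k, ((colCount (ω k)).descFactorial 3 : ℝ) := by
  simp_rw [← tripleSum_bit]
  exact tripleSum_sum _

theorem sum_commonCount_eq (ω : κ → ι → Bool) (i : ι) :
    (∑ j, if i ≠ j then commonCount i j ω else 0) = ∑ k, colDegree i (ω k) := by
  have h : ∀ j, (if i ≠ j then commonCount i j ω else 0) =
      ∑ k, if i ≠ j then bit (ω k) i * bit (ω k) j else 0 := by
    intro j
    split_ifs <;> simp [commonCount]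
  simp_rw [h]
  rw [Finset.sum_comm]
  refine Finset.sum_congr rfl fun k _ => ?_
  rw [colDegree, sum_ite_ne fun j => bit (ω k) i * bit (ω k) j,
    ← Finset.sum_erase_add _ _ (Finset.mem_univ i)]
  ring

/-- For fixed `i`, the sum over distinct `j, l` is the square of `∑ k, colDegree i (ω k)` minus its
terms with `j = l`. The square splits by whether the two attributes differ. Equal attributes give `X
(X - 1) ^ 2 = (X)₃ + (X)₂` per column, and the `(X)₂` part merges with the subtracted squares into
`C (C - 1)`. -/
theorem tripleSum_commonCount_mul [DecidableEq κ] (ω : κ → ι → Bool) :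
    (tripleSum fun i j l => commonCount i j ω * commonCount i l ω) =
      ∑ i, ∑ q ∈ Finset.univ.offDiag, colDegree i (ω q.1) * colDegree i (ω q.2) +
        ∑ k, ((colCount (ω k)).descFactorial 3 : ℝ) -
        pairSum fun i j => commonCount i j ω * (commonCount i j ω - 1) := by
  have h1 : ∀ i, (∑ j, ∑ l, if i ≠ j ∧ i ≠ l ∧ j ≠ l then
      commonCount i j ω * commonCount i l ω else 0) =
      (∑ k, colDegree i (ω k)) * (∑ k, colDegree i (ω k)) -
        ∑ j, (if i ≠ j then commonCount i j ω * commonCount i j ω else 0) := by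
    intro i
    rw [← sum_commonCount_eq, Finset.sum_mul_sum, ← Finset.sum_sub_distrib]
    refine Finset.sum_congr rfl fun j _ => ?_
    have : ∀ l, (if i ≠ j ∧ i ≠ l ∧ j ≠ l then commonCount i j ω * commonCount i l ω else 0) =
        (if i ≠ j then commonCount i j ω else 0) * (if i ≠ l then commonCount i l ω else 0) -
          if j = l then (if i ≠ j then commonCount i j ω * commonCount i j ω else 0) else 0 := by
      intro l
      by_cases a : i = j <;> by_cases b : i = l <;> by_cases c : j = l <;> simp_all
    simp_rw [this, Finset.sum_sub_distrib]
    simp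
  have h2 : ∀ k, ∑ i, colDegree i (ω k) * colDegree i (ω k) =
      ((colCount (ω k)).descFactorial 3 : ℝ) + ((colCount (ω k)).descFactorial 2 : ℝ) := by
    intro k
    have : ∀ i, colDegree i (ω k) * colDegree i (ω k) =
        bit (ω k) i * ((colCount (ω k) - 1) * (colCount (ω k) - 1)) := by
      intro i
      rw [colDegree_eq]
      linear_combination ((colCount (ω k) : ℝ) - 1) * (colCount (ω k) - 1) * bit_mul_self (ω k) i
    simp_rw [this, ← Finset.sum_mul, sum_bit]
    rw [cast_descFactorial_two, cast_descFactorial_three]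
    ring
  have h3 : (pairSum fun i j => commonCount i j ω * (commonCount i j ω - 1)) =
      (∑ i, ∑ j, if i ≠ j then commonCount i j ω * commonCount i j ω else 0) -
        pairSum fun i j => commonCount i j ω := by
    simp_rw [pairSum, ← Finset.sum_sub_distrib]
    refine Finset.sum_congr rfl fun i _ => Finset.sum_congr rfl fun j _ => ?_
    split_ifs <;> ring
  rw [h3, pairSum_commonCount, tripleSum]
  simp_rw [h1, Finset.sum_sub_distrib, sum_mul_sum_eq_diag_add_offDiag, Finset.sum_add_distrib]
  rw [Finset.sum_comm (f := fun i k => colDegree i (ω k) * colDegree i (ω k))]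
  simp_rw [h2, Finset.sum_add_distrib]
  ring

/-- With `c` the mean of `a k`, this is the Hoeffding decomposition into a degenerate quadratic
part, a linear part and a constant. -/
theorem sum_offDiag_eq_sub_const [DecidableEq κ] (a : κ → ℝ) (c : ℝ) :
    ∑ q ∈ Finset.univ.offDiag, a q.1 * a q.2 =
      ∑ q ∈ Finset.univ.offDiag, (a q.1 - c) * (a q.2 - c) +
        2 * ((Fintype.card κ : ℝ) - 1) * c * ∑ k, a k -
        (Fintype.card κ : ℝ) * ((Fintype.card κ : ℝ) - 1) * c ^ 2 := by
  have h1 := sum_mul_sum_eq_diag_add_offDiag a a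
  have h2 := sum_mul_sum_eq_diag_add_offDiag (fun k => a k - c) fun k => a k - c
  have h3 : ∀ k, (a k - c) * (a k - c) = a k * a k - 2 * c * a k + c ^ 2 := fun k => by ring
  simp_rw [h3, Finset.sum_add_distrib, Finset.sum_sub_distrib, ← Finset.mul_sum, Finset.sum_const,
    Finset.card_univ, nsmul_eq_mul] at h2
  linarith

end Matrix

/-! ### L¹ deviation bounds for the three counts -/

section Bounds

theorem integral_abs_le_sqrt {α : Type*} [MeasurableSpace α] [Finite α]
    [MeasurableSingletonClass α] (γ : Measure α) [IsProbabilityMeasure γ] (f : α → ℝ) {v : ℝ}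
    (h : ∫ a, f a ^ 2 ∂γ ≤ v) : ∫ a, |f a| ∂γ ≤ √v := by
  refine Real.le_sqrt_of_sq_le (le_trans ?_ h)
  have h1 := integral_sub_integral_mul γ (fun a => |f a|) fun a => |f a|
  have h2 : 0 ≤ ∫ a, (|f a| - ∫ b, |f b| ∂γ) * (|f a| - ∫ b, |f b| ∂γ) ∂γ :=
    integral_nonneg fun a => mul_self_nonneg _
  simp only [abs_mul_abs_self] at h1
  simp_rw [sq]
  linarith

variable {κ ι : Type*} [Fintype κ] [Fintype ι]

theorem integral_pairSum_le {α : Type*} [MeasurableSpace α] [Finite α] [DecidableEq ι]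
    [MeasurableSingletonClass α] (γ : Measure α) [IsProbabilityMeasure γ] (f : ι → ι → α → ℝ)
    {b : ℝ} (hb : 0 ≤ b) (h : ∀ i j, i ≠ j → ∫ a, f i j a ∂γ ≤ b) :
    ∫ a, pairSum (fun i j => f i j a) ∂γ ≤ (Fintype.card ι : ℝ) ^ 2 * b := by
  unfold pairSum
  rw [integral_finsetSum _ fun _ _ => Integrable.of_finite]
  calc _ ≤ ∑ _i : ι, ∑ _j : ι, b := by
        refine Finset.sum_le_sum fun i _ => ?_
        rw [integral_finsetSum _ fun _ _ => Integrable.of_finite]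
        refine Finset.sum_le_sum fun j _ => ?_
        split_ifs with hij
        · exact h i j hij
        · simpa using hb
    _ = _ := by simp; ring

theorem integral_tripleSum_le {α : Type*} [MeasurableSpace α] [Finite α] [DecidableEq ι]
    [MeasurableSingletonClass α] (γ : Measure α) [IsProbabilityMeasure γ] (f : ι → ι → ι → α → ℝ)
    {b : ℝ} (hb : 0 ≤ b) (h : ∀ i j l, i ≠ j → i ≠ l → j ≠ l → ∫ a, f i j l a ∂γ ≤ b) :
    ∫ a, tripleSum (fun i j l => f i j l a) ∂γ ≤ (Fintype.card ι : ℝ) ^ 3 * b := by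
  unfold tripleSum
  rw [integral_finsetSum _ fun _ _ => Integrable.of_finite]
  calc _ ≤ ∑ _i : ι, ∑ _j : ι, ∑ _l : ι, b := by
        refine Finset.sum_le_sum fun i _ => ?_
        rw [integral_finsetSum _ fun _ _ => Integrable.of_finite]
        refine Finset.sum_le_sum fun j _ => ?_
        rw [integral_finsetSum _ fun _ _ => Integrable.of_finite]
        refine Finset.sum_le_sum fun l _ => ?_
        split_ifs with hij
        · exact h i j l hij.1 hij.2.1 hij.2.2
        · simpa using hb
    _ = _ := by simp; ring

variable (κ ι) (ν : Measure Bool) [IsProbabilityMeasure ν]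

/-- The law of a matrix with independent entries of law `ν`. -/
noncomputable abbrev matrixLaw : Measure (κ → ι → Bool) := Measure.pi fun _ => Measure.pi fun _ => ν

variable {κ ι}

theorem integral_abs_sum_descFactorial_two_le :
    ∫ ω, |∑ k, ((colCount (ω k)).descFactorial 2 : ℝ) -
      Fintype.card κ * (Fintype.card ι * (Fintype.card ι - 1) * ν.real {true} ^ 2)|
      ∂matrixLaw κ ι ν ≤
    √(Fintype.card κ * (((Fintype.card ι : ℝ) * ν.real {true}) ^ 4 +
      4 * ((Fintype.card ι : ℝ) * ν.real {true}) ^ 3 +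
        2 * ((Fintype.card ι : ℝ) * ν.real {true}) ^ 2)) := by
  refine integral_abs_le_sqrt _ _ ?_
  have h := integral_pi_sum_sub_sq_le (κ := κ) (Measure.pi fun _ : ι => ν)
    fun c => ((colCount c).descFactorial 2 : ℝ)
  rw [integral_descFactorial_colCount, cast_descFactorial_two] at h
  refine h.trans ?_
  gcongr
  exact integral_descFactorial_two_sq_le ν

theorem integral_abs_sum_descFactorial_three_le :
    ∫ ω, |∑ k, ((colCount (ω k)).descFactorial 3 : ℝ) -
      Fintype.card κ * (Fintype.card ι * (Fintype.card ι - 1) * (Fintype.card ι - 2) *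
        ν.real {true} ^ 3)| ∂matrixLaw κ ι ν ≤
    √(Fintype.card κ * (((Fintype.card ι : ℝ) * ν.real {true}) ^ 6 +
      9 * ((Fintype.card ι : ℝ) * ν.real {true}) ^ 5 +
        18 * ((Fintype.card ι : ℝ) * ν.real {true}) ^ 4 +
        6 * ((Fintype.card ι : ℝ) * ν.real {true}) ^ 3)) := by
  refine integral_abs_le_sqrt _ _ ?_
  have h := integral_pi_sum_sub_sq_le (κ := κ) (Measure.pi fun _ : ι => ν)
    fun c => ((colCount c).descFactorial 3 : ℝ)
  rw [integral_descFactorial_colCount, cast_descFactorial_three] at h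
  refine h.trans ?_
  gcongr
  exact integral_descFactorial_three_sq_le ν

theorem integral_pairSum_commonCount_le [DecidableEq ι] :
    ∫ ω, pairSum (fun i j => commonCount i j ω * (commonCount i j ω - 1)) ∂matrixLaw κ ι ν ≤
      (Fintype.card ι : ℝ) ^ 2 * ((Fintype.card κ : ℝ) ^ 2 * ν.real {true} ^ 4) := by
  classical
  exact integral_pairSum_le _ (fun i j ω => commonCount i j ω * (commonCount i j ω - 1))
    (by positivity) fun i j h => integral_commonCount_mul_sub_one_le ν h

theorem integral_abs_numEdges_le :
    ∫ ω, |2 * (numEdges (attrGraph ω) : ℝ) -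
      Fintype.card κ * (Fintype.card ι * (Fintype.card ι - 1) * ν.real {true} ^ 2)|
      ∂matrixLaw κ ι ν ≤
    √(Fintype.card κ * (((Fintype.card ι : ℝ) * ν.real {true}) ^ 4 +
      4 * ((Fintype.card ι : ℝ) * ν.real {true}) ^ 3 +
        2 * ((Fintype.card ι : ℝ) * ν.real {true}) ^ 2)) +
    (Fintype.card ι : ℝ) ^ 2 * ((Fintype.card κ : ℝ) ^ 2 * ν.real {true} ^ 4) := by
  classical
  refine le_trans ?_ (add_le_add (integral_abs_sum_descFactorial_two_le (κ := κ) (ι := ι) ν)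
    (integral_pairSum_commonCount_le (κ := κ) (ι := ι) ν))
  rw [← integral_add .of_finite .of_finite]
  refine integral_mono .of_finite .of_finite fun ω => ?_
  have h := abs_pairSum_sub_le (abs_link_sub_le ω)
  rw [← two_mul_numEdges_attrGraph, pairSum_commonCount] at h
  simp only
  have h2 := abs_add_le (∑ k, ((colCount (ω k)).descFactorial 2 : ℝ) -
    Fintype.card κ * (Fintype.card ι * (Fintype.card ι - 1) * ν.real {true} ^ 2))
    (2 * (numEdges (attrGraph ω) : ℝ) - ∑ k, ((colCount (ω k)).descFactorial 2 : ℝ))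
  rw [sub_add_sub_cancel'] at h2
  linarith

theorem integral_abs_numTriangles_le :
    ∫ ω, |6 * (numTriangles (attrGraph ω) : ℝ) -
      Fintype.card κ * (Fintype.card ι * (Fintype.card ι - 1) * (Fintype.card ι - 2) *
        ν.real {true} ^ 3)| ∂matrixLaw κ ι ν ≤
    √(Fintype.card κ * (((Fintype.card ι : ℝ) * ν.real {true}) ^ 6 +
      9 * ((Fintype.card ι : ℝ) * ν.real {true}) ^ 5 +
        18 * ((Fintype.card ι : ℝ) * ν.real {true}) ^ 4 +
        6 * ((Fintype.card ι : ℝ) * ν.real {true}) ^ 3)) +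
    (Fintype.card ι : ℝ) ^ 3 * ((Fintype.card κ : ℝ) ^ 2 *
      (2 * ν.real {true} ^ 5 + Fintype.card κ * ν.real {true} ^ 6) +
      (Fintype.card κ : ℝ) ^ 3 * ν.real {true} ^ 6) := by
  classical
  have hE := integral_tripleSum_le (matrixLaw κ ι ν) (fun i j l ω =>
    commonCount i j ω * (commonCount i j ω - 1) * commonCount i l ω + rainbowCount i j l ω)
    (b := (Fintype.card κ : ℝ) ^ 2 *
      (2 * ν.real {true} ^ 5 + Fintype.card κ * ν.real {true} ^ 6) +
      (Fintype.card κ : ℝ) ^ 3 * ν.real {true} ^ 6) (by positivity) fun i j l h h' h'' => by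
      rw [integral_add .of_finite .of_finite]
      exact add_le_add (integral_commonCount_mul_sub_one_mul_le ν h h' h'')
        (integral_rainbowCount_le ν h h' h'')
  refine le_trans ?_ (add_le_add (integral_abs_sum_descFactorial_three_le (κ := κ) (ι := ι) ν) hE)
  rw [← integral_add .of_finite .of_finite]
  refine integral_mono .of_finite .of_finite fun ω => ?_
  have h := abs_tripleSum_sub_le (abs_link_mul_link_mul_link_sub_le ω)
  rw [← six_mul_numTriangles_attrGraph, tripleSum_commonCount₃] at h
  simp only
  have h2 := abs_add_le (∑ k, ((colCount (ω k)).descFactorial 3 : ℝ) -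
    Fintype.card κ * (Fintype.card ι * (Fintype.card ι - 1) * (Fintype.card ι - 2) *
        ν.real {true} ^ 3))
    (6 * (numTriangles (attrGraph ω) : ℝ) - ∑ k, ((colCount (ω k)).descFactorial 3 : ℝ))
  rw [sub_add_sub_cancel'] at h2
  linarith

variable [DecidableEq ι]

/-- The two terms come from the `N` variances and the at most `N ^ 2` covariances. A covariance is
bounded below by minus the product of the means, since `colDegree` is nonnegative. -/
theorem sum_sq_covariance_colDegree_le :
    ∑ i : ι, ∑ j : ι, (∫ c, (colDegree i c - (Fintype.card ι - 1) * ν.real {true} ^ 2) *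
      (colDegree j c - (Fintype.card ι - 1) * ν.real {true} ^ 2)
      ∂Measure.pi (fun _ : ι => ν)) ^ 2 ≤
      Fintype.card ι * (Fintype.card ι * ν.real {true} ^ 2 +
        (Fintype.card ι) ^ 2 * ν.real {true} ^ 3) ^ 2 +
      (Fintype.card ι) ^ 2 * (ν.real {true} ^ 2 * (1 + Fintype.card ι * ν.real {true}) ^ 2 +
        Fintype.card ι * ν.real {true} ^ 3) ^ 2 := by
  set p := ν.real {true} with hpdef
  set N : ℝ := (Fintype.card ι : ℝ) with hN
  have hp : 0 ≤ p := measureReal_nonneg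
  set a := N * p ^ 2 + N ^ 2 * p ^ 3
  set b := p ^ 2 * (1 + N * p) ^ 2 + N * p ^ 3
  calc _ ≤ ∑ i : ι, ∑ j : ι, ((if i = j then a ^ 2 else 0) + b ^ 2) := by
        refine Finset.sum_le_sum fun i _ => Finset.sum_le_sum fun j _ => ?_
        have hN1 : 1 ≤ N := by
          exact Nat.one_le_cast.2 (Fintype.card_pos_iff.2 ⟨i⟩)
        have hc := integral_sub_integral_mul (Measure.pi fun _ : ι => ν) (colDegree i) (colDegree j)
        rw [integral_colDegree, integral_colDegree] at hc
        rw [hc]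
        split_ifs with hij
        · subst hij
          have h1 := integral_colDegree_sq_le ν i
          have h2 : 0 ≤ ∫ c, (colDegree i c - (N - 1) * p ^ 2) * (colDegree i c - (N - 1) * p ^ 2)
              ∂Measure.pi (fun _ : ι => ν) := integral_nonneg fun c => mul_self_nonneg _
          rw [hc] at h2
          simp_rw [sq (colDegree i _)] at h1
          have h3 : ∫ c, colDegree i c * colDegree i c ∂Measure.pi (fun _ : ι => ν) -
              (N - 1) * p ^ 2 * ((N - 1) * p ^ 2) ≤ a := by
            nlinarith [mul_self_nonneg ((N - 1) * p ^ 2)]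
          nlinarith [sq_nonneg b]
        · have h1 := integral_colDegree_mul_le ν hij
          have h2 : 0 ≤ ∫ c, colDegree i c * colDegree j c ∂Measure.pi (fun _ : ι => ν) :=
            integral_nonneg fun c => mul_nonneg (colDegree_nonneg _ _) (colDegree_nonneg _ _)
          rw [zero_add]
          apply sq_le_sq'
          · have e1 : (N - 1) * p ^ 2 * ((N - 1) * p ^ 2) ≤ (N * p ^ 2) * (N * p ^ 2) := by
              gcongr <;> linarith
            have e2 : 0 ≤ N * p ^ 3 := by positivity
            have e3 : (N * p ^ 2) * (N * p ^ 2) ≤ p ^ 2 * (1 + N * p) ^ 2 := by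
              have : 0 ≤ p ^ 2 * (1 + 2 * (N * p)) := by positivity
              nlinarith
            simp only [b]
            linarith
          · nlinarith [mul_self_nonneg ((N - 1) * p ^ 2)]
    _ = _ := by
        simp [Finset.sum_add_distrib, hN]
        ring

variable [DecidableEq κ]

/-- The five terms bound, in order: the linear part of the U-statistic, its degenerate quadratic
part, stars made by a single attribute, the correction for `j = l`, and the replacement of `link` by
`commonCount`. -/
theorem integral_abs_numTwoStars_le [Nonempty κ] [Nonempty ι] :
    ∫ ω, |2 * (numTwoStars (attrGraph ω) : ℝ) -
      (Fintype.card ι * Fintype.card κ * (Fintype.card κ - 1) *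
        ((Fintype.card ι - 1) * ν.real {true} ^ 2) ^ 2 +
      Fintype.card κ * (Fintype.card ι * (Fintype.card ι - 1) * (Fintype.card ι - 2) *
        ν.real {true} ^ 3))| ∂matrixLaw κ ι ν ≤
    2 * Fintype.card κ * Fintype.card ι * ν.real {true} ^ 2 *
      √(Fintype.card κ * (((Fintype.card ι : ℝ) * ν.real {true}) ^ 4 +
      4 * ((Fintype.card ι : ℝ) * ν.real {true}) ^ 3 +
        2 * ((Fintype.card ι : ℝ) * ν.real {true}) ^ 2)) +
    √(2 * (Fintype.card κ : ℝ) ^ 2 * (Fintype.card ι * (Fintype.card ι * ν.real {true} ^ 2 +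
        (Fintype.card ι) ^ 2 * ν.real {true} ^ 3) ^ 2 +
      (Fintype.card ι) ^ 2 * (ν.real {true} ^ 2 * (1 + Fintype.card ι * ν.real {true}) ^ 2 +
        Fintype.card ι * ν.real {true} ^ 3) ^ 2)) +
    √(Fintype.card κ * (((Fintype.card ι : ℝ) * ν.real {true}) ^ 6 +
      9 * ((Fintype.card ι : ℝ) * ν.real {true}) ^ 5 +
        18 * ((Fintype.card ι : ℝ) * ν.real {true}) ^ 4 +
        6 * ((Fintype.card ι : ℝ) * ν.real {true}) ^ 3)) +
    (Fintype.card ι : ℝ) ^ 2 * ((Fintype.card κ : ℝ) ^ 2 * ν.real {true} ^ 4) +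
    (Fintype.card ι : ℝ) ^ 3 * (2 * ((Fintype.card κ : ℝ) ^ 2 *
      (2 * ν.real {true} ^ 5 + Fintype.card κ * ν.real {true} ^ 6))) := by
  have hE := integral_tripleSum_le (matrixLaw κ ι ν) (fun i j l ω =>
    commonCount i j ω * (commonCount i j ω - 1) * commonCount i l ω +
      commonCount i l ω * (commonCount i l ω - 1) * commonCount i j ω)
    (b := 2 * ((Fintype.card κ : ℝ) ^ 2 *
      (2 * ν.real {true} ^ 5 + Fintype.card κ * ν.real {true} ^ 6))) (by positivity)
      fun i j l h h' h'' => by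
      rw [integral_add .of_finite .of_finite, two_mul]
      exact add_le_add (integral_commonCount_mul_sub_one_mul_le ν h h' h'')
        (integral_commonCount_mul_sub_one_mul_le ν h' h h''.symm)
  have hF := integral_abs_le_sqrt _ _ ((integral_pi_sum_offDiag_sq_le (κ := κ)
    (Measure.pi fun _ : ι => ν)
    (fun i c => colDegree i c - (Fintype.card ι - 1) * ν.real {true} ^ 2) fun i => by
      rw [← integral_colDegree ν i]; exact integral_sub_integral_eq_zero _ _).trans
      (mul_le_mul_of_nonneg_left (sum_sq_covariance_colDegree_le ν) (by positivity)))
  set p := ν.real {true} with hpdef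
  have hp : 0 ≤ p := measureReal_nonneg
  set N : ℝ := (Fintype.card ι : ℝ) with hN
  set m : ℝ := (Fintype.card κ : ℝ) with hm
  have hN1 : 1 ≤ N := Nat.one_le_cast.2 Fintype.card_pos
  have hm1 : 1 ≤ m := Nat.one_le_cast.2 Fintype.card_pos
  have hA2 := mul_le_mul_of_nonneg_left (integral_abs_sum_descFactorial_two_le (κ := κ) (ι := ι) ν)
    (by positivity : 0 ≤ 2 * m * N * p ^ 2)
  rw [← integral_const_mul] at hA2
  refine le_trans ?_ (add_le_add (add_le_add (add_le_add (add_le_add hA2 hF)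
    (integral_abs_sum_descFactorial_three_le (κ := κ) (ι := ι) ν))
    (integral_pairSum_commonCount_le (κ := κ) (ι := ι) ν)) hE)
  rw [← integral_add .of_finite .of_finite, ← integral_add .of_finite .of_finite,
    ← integral_add .of_finite .of_finite, ← integral_add .of_finite .of_finite]
  refine integral_mono .of_finite .of_finite fun ω => ?_
  have h := abs_tripleSum_sub_le (abs_link_mul_link_sub_le ω)
  rw [← two_mul_numTwoStars_attrGraph, tripleSum_commonCount_mul] at h
  have hQ : 0 ≤ pairSum fun i j => commonCount i j ω * (commonCount i j ω - 1) :=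
    Finset.sum_nonneg fun i _ => Finset.sum_nonneg fun j _ => by
      split_ifs
      · exact (abs_nonneg _).trans (abs_link_sub_le ω i j)
      · exact le_rfl
  have hc : 0 ≤ (N - 1) * p ^ 2 := mul_nonneg (by linarith) (by positivity)
  -- Summing the linear parts over `i` turns `∑ i, colDegree i` into `(X)₂`, so the linear
  -- fluctuation is a multiple of the deviation already controlled for edges.
  have hAS : ∑ i, ∑ q ∈ Finset.univ.offDiag, colDegree i (ω q.1) * colDegree i (ω q.2) =
      ∑ i, ∑ q ∈ Finset.univ.offDiag, (colDegree i (ω q.1) - (N - 1) * p ^ 2) *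
        (colDegree i (ω q.2) - (N - 1) * p ^ 2) +
      2 * (m - 1) * ((N - 1) * p ^ 2) * (∑ k, ((colCount (ω k)).descFactorial 2 : ℝ) -
        m * (N * (N - 1) * p ^ 2)) + N * m * (m - 1) * ((N - 1) * p ^ 2) ^ 2 := by
    rw [Finset.sum_congr rfl fun i _ =>
      sum_offDiag_eq_sub_const (fun k => colDegree i (ω k)) ((N - 1) * p ^ 2)]
    simp_rw [Finset.sum_sub_distrib, Finset.sum_add_distrib, ← Finset.mul_sum]
    rw [Finset.sum_comm (f := fun i k => colDegree i (ω k))]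
    simp_rw [sum_colDegree]
    simp only [Finset.sum_const, Finset.card_univ, nsmul_eq_mul, ← hN, ← hm]
    ring
  rw [hAS] at h
  simp only
  set A2 := ∑ k, ((colCount (ω k)).descFactorial 2 : ℝ) - m * (N * (N - 1) * p ^ 2)
  set FF := ∑ i, ∑ q ∈ Finset.univ.offDiag, (colDegree i (ω q.1) - (N - 1) * p ^ 2) *
        (colDegree i (ω q.2) - (N - 1) * p ^ 2)
  set A3 := ∑ k, ((colCount (ω k)).descFactorial 3 : ℝ)
  set Q := pairSum fun i j => commonCount i j ω * (commonCount i j ω - 1)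
  have hA : |2 * (m - 1) * ((N - 1) * p ^ 2) * A2| ≤ 2 * m * N * p ^ 2 * |A2| := by
    rw [abs_mul, abs_of_nonneg (mul_nonneg (by linarith) hc)]
    refine mul_le_mul_of_nonneg_right ?_ (abs_nonneg _)
    have : 2 * (m - 1) * ((N - 1) * p ^ 2) ≤ 2 * m * (N * p ^ 2) := by
      gcongr <;> linarith
    linarith
  have e1 := abs_le.1 h
  have e2 := abs_le.1 hA
  have e3 := neg_abs_le FF
  have e4 := le_abs_self FF
  have e5 := neg_abs_le (A3 - m * (N * (N - 1) * (N - 2) * p ^ 3))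
  have e6 := le_abs_self (A3 - m * (N * (N - 1) * (N - 2) * p ^ 3))
  rw [abs_le]
  constructor <;> linarith [e1.1, e1.2, e2.1, e2.2]

end Bounds

/-! ### Sizes of the error terms, with `y = 1 / n` and `m / n`, `p n` bounded by `D` -/

section RealBounds

variable {N m p n y D : ℝ}

/-- Here `N p ≤ D u` with `u = N / n ≤ 1`, so the lowest power of `u` and the highest power of `D`
dominate; `7 = 1 + 4 + 2`. -/
theorem moment_two_le (hN : 0 ≤ N) (hNn : N ≤ n) (hy : 0 ≤ y) (hny : n * y = 1) (hD : 1 ≤ D)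
    (hm : m ≤ D * n) (hp0 : 0 ≤ p) (hp : p ≤ D * y) :
    m * ((N * p) ^ 4 + 4 * (N * p) ^ 3 + 2 * (N * p) ^ 2) ≤ 7 * D ^ 5 * (N ^ 2 * y) := by
  set u := N * y with hu
  have hu0 : 0 ≤ u := mul_nonneg hN hy
  have hu1 : u ≤ 1 := by rw [← hny]; exact mul_le_mul_of_nonneg_right hNn hy
  have ht : N * p ≤ D * u := by
    calc N * p ≤ N * (D * y) := by gcongr
      _ = _ := by ring
  have ht0 : 0 ≤ N * p := mul_nonneg hN hp0
  have hD0 : 0 ≤ D := by linarith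
  have hn0 : 0 ≤ n := hN.trans hNn
  have h4 : (D * u) ^ 4 ≤ D ^ 4 * u ^ 2 := by
    rw [mul_pow]
    have := pow_le_pow_of_le_one hu0 hu1 (show 2 ≤ 4 by norm_num)
    gcongr
  have h3 : (D * u) ^ 3 ≤ D ^ 4 * u ^ 2 := by
    rw [mul_pow]
    have := pow_le_pow_right₀ hD (show 3 ≤ 4 by norm_num)
    have := pow_le_pow_of_le_one hu0 hu1 (show 2 ≤ 3 by norm_num)
    gcongr
  have h2 : (D * u) ^ 2 ≤ D ^ 4 * u ^ 2 := by
    rw [mul_pow]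
    have := pow_le_pow_right₀ hD (show 2 ≤ 4 by norm_num)
    gcongr
  calc _ ≤ (D * n) * ((D * u) ^ 4 + 4 * (D * u) ^ 3 + 2 * (D * u) ^ 2) := by gcongr
    _ ≤ (D * n) * (7 * (D ^ 4 * u ^ 2)) := by gcongr; linarith
    _ = 7 * D ^ 5 * (N ^ 2 * y) * (n * y) := by rw [hu]; ring
    _ = _ := by rw [hny, mul_one]

theorem moment_three_le (hN : 0 ≤ N) (hNn : N ≤ n) (hy : 0 ≤ y) (hny : n * y = 1) (hD : 1 ≤ D)
    (hm : m ≤ D * n) (hp0 : 0 ≤ p) (hp : p ≤ D * y) :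
    m * ((N * p) ^ 6 + 9 * (N * p) ^ 5 + 18 * (N * p) ^ 4 + 6 * (N * p) ^ 3) ≤
      34 * D ^ 7 * (N ^ 3 * y ^ 2) := by
  set u := N * y with hu
  have hu0 : 0 ≤ u := mul_nonneg hN hy
  have hu1 : u ≤ 1 := by rw [← hny]; exact mul_le_mul_of_nonneg_right hNn hy
  have ht : N * p ≤ D * u := by
    calc N * p ≤ N * (D * y) := by gcongr
      _ = _ := by ring
  have ht0 : 0 ≤ N * p := mul_nonneg hN hp0
  have hD0 : 0 ≤ D := by linarith
  have hn0 : 0 ≤ n := hN.trans hNn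
  have h : ∀ k, 3 ≤ k → k ≤ 6 → (D * u) ^ k ≤ D ^ 6 * u ^ 3 := by
    intro k hk hk'
    rw [mul_pow]
    have := pow_le_pow_right₀ hD hk'
    have := pow_le_pow_of_le_one hu0 hu1 hk
    gcongr
  calc _ ≤ (D * n) * ((D * u) ^ 6 + 9 * (D * u) ^ 5 + 18 * (D * u) ^ 4 + 6 * (D * u) ^ 3) := by
        gcongr
    _ ≤ (D * n) * (34 * (D ^ 6 * u ^ 3)) := by
        gcongr
        linarith [h 6 (by norm_num) (by norm_num), h 5 (by norm_num) (by norm_num),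
          h 4 (by norm_num) (by norm_num), h 3 (by norm_num) (by norm_num)]
    _ = 34 * D ^ 7 * (N ^ 3 * y ^ 2) * (n * y) := by rw [hu]; ring
    _ = _ := by rw [hny, mul_one]

theorem pair_error_le (hny : n * y = 1) (hD : 1 ≤ D)
    (hm0 : 0 ≤ m) (hm : m ≤ D * n) (hp0 : 0 ≤ p) (hp : p ≤ D * y) :
    N ^ 2 * (m ^ 2 * p ^ 4) ≤ D ^ 6 * (N ^ 2 * y ^ 2) := by
  have hD0 : 0 ≤ D := by linarith
  calc _ ≤ N ^ 2 * ((D * n) ^ 2 * (D * y) ^ 4) := by gcongr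
    _ = D ^ 6 * (N ^ 2 * y ^ 2) * (n * y) ^ 2 := by ring
    _ = _ := by rw [hny]; ring

theorem triple_error_le (hN : 0 ≤ N) (hn0 : 0 ≤ n) (hy : 0 ≤ y) (hny : n * y = 1) (hD : 1 ≤ D)
    (hm0 : 0 ≤ m) (hm : m ≤ D * n) (hp0 : 0 ≤ p) (hp : p ≤ D * y) :
    N ^ 3 * (m ^ 2 * (2 * p ^ 5 + m * p ^ 6)) ≤ 3 * D ^ 9 * (N ^ 3 * y ^ 3) := by
  have hD0 : 0 ≤ D := by linarith
  have h79 : D ^ 7 ≤ D ^ 9 := pow_le_pow_right₀ hD (by norm_num)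
  calc _ ≤ N ^ 3 * ((D * n) ^ 2 * (2 * (D * y) ^ 5 + (D * n) * (D * y) ^ 6)) := by gcongr
    _ = (2 * D ^ 7 * (n * y) ^ 2 + D ^ 9 * (n * y) ^ 3) * (N ^ 3 * y ^ 3) := by ring
    _ = (2 * D ^ 7 + D ^ 9) * (N ^ 3 * y ^ 3) := by rw [hny]; ring
    _ ≤ _ := by gcongr; linarith

theorem rainbow_error_le (hN : 0 ≤ N) (hn0 : 0 ≤ n) (hny : n * y = 1) (hD : 1 ≤ D)
    (hm0 : 0 ≤ m) (hm : m ≤ D * n) (hp0 : 0 ≤ p) (hp : p ≤ D * y) :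
    N ^ 3 * (m ^ 3 * p ^ 6) ≤ D ^ 9 * (N ^ 3 * y ^ 3) := by
  have hD0 : 0 ≤ D := by linarith
  calc _ ≤ N ^ 3 * ((D * n) ^ 3 * (D * y) ^ 6) := by gcongr
    _ = D ^ 9 * (N ^ 3 * y ^ 3) * (n * y) ^ 3 := by ring
    _ = _ := by rw [hny]; ring

theorem chaos_error_le (hN : 1 ≤ N) (hNn : N ≤ n) (hny : n * y = 1) (hD : 1 ≤ D)
    (hm0 : 0 ≤ m) (hm : m ≤ D * n) (hp0 : 0 ≤ p) (hp : p ≤ D * y) :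
    2 * m ^ 2 * (N * (N * p ^ 2 + N ^ 2 * p ^ 3) ^ 2 +
      N ^ 2 * (p ^ 2 * (1 + N * p) ^ 2 + N * p ^ 3) ^ 2) ≤ 58 * D ^ 10 * (N ^ 3 * y ^ 2) := by
  have hD0 : 0 ≤ D := by linarith
  have hN0 : 0 ≤ N := by linarith
  have hn0 : 0 ≤ n := by linarith
  have ht : N * p ≤ D := by
    calc N * p ≤ n * (D * y) := by gcongr
      _ = D * (n * y) := by ring
      _ = D := by rw [hny, mul_one]
  have ht0 : 0 ≤ N * p := mul_nonneg hN0 hp0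
  have h1 : N * p ^ 2 + N ^ 2 * p ^ 3 ≤ N * p ^ 2 * (2 * D) := by
    calc _ = N * p ^ 2 * (1 + N * p) := by ring
      _ ≤ _ := by gcongr; linarith
  have h2 : p ^ 2 * (1 + N * p) ^ 2 + N * p ^ 3 ≤ p ^ 2 * (5 * D ^ 2) := by
    calc _ = p ^ 2 * ((1 + N * p) ^ 2 + N * p) := by ring
      _ ≤ p ^ 2 * ((1 + D) ^ 2 + D) := by gcongr
      _ ≤ _ := by gcongr; nlinarith
  have h24 : D ^ 2 ≤ D ^ 4 := pow_le_pow_right₀ hD (by norm_num)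
  have h23 : N ^ 2 ≤ N ^ 3 := pow_le_pow_right₀ hN (by norm_num)
  calc _ ≤ 2 * (D * n) ^ 2 * (N * (N * p ^ 2 * (2 * D)) ^ 2 + N ^ 2 * (p ^ 2 * (5 * D ^ 2)) ^ 2) := by
        gcongr
    _ = 2 * (D * n) ^ 2 * p ^ 4 * (4 * D ^ 2 * N ^ 3 + 25 * D ^ 4 * N ^ 2) := by ring
    _ ≤ 2 * (D * n) ^ 2 * (D * y) ^ 4 * (4 * D ^ 4 * N ^ 3 + 25 * D ^ 4 * N ^ 3) := by gcongr
    _ = 58 * D ^ 10 * (N ^ 3 * y ^ 2) * (n * y) ^ 2 := by ring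
    _ = _ := by rw [hny]; ring

theorem sqrt_le_const_mul_sqrt {v c C s : ℝ} (h : v ≤ c * s) (hc : c ≤ C ^ 2) (hC : 0 ≤ C)
    (hs : 0 ≤ s) : √v ≤ C * √s := by
  calc √v ≤ √(C ^ 2 * s) := Real.sqrt_le_sqrt (h.trans (by gcongr))
    _ = _ := by rw [Real.sqrt_mul (sq_nonneg C), Real.sqrt_sq hC]

end RealBounds

/-! ### Deviation bounds with a common constant `30 * D ^ 11` -/

section Bounds

variable {κ ι : Type*} [Fintype κ] [Fintype ι] (ν : Measure Bool) [IsProbabilityMeasure ν]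
  {n y D : ℝ}

theorem integral_abs_numEdges_le_const (hNn : (Fintype.card ι : ℝ) ≤ n) (hy : 0 ≤ y)
    (hny : n * y = 1) (hD : 1 ≤ D) (hm : (Fintype.card κ : ℝ) ≤ D * n)
    (hp : ν.real {true} ≤ D * y) :
    ∫ ω, |2 * (numEdges (attrGraph ω) : ℝ) -
      Fintype.card κ * (Fintype.card ι * (Fintype.card ι - 1) * ν.real {true} ^ 2)|
      ∂matrixLaw κ ι ν ≤
    30 * D ^ 11 * (√((Fintype.card ι : ℝ) ^ 2 * y) + (Fintype.card ι : ℝ) ^ 2 * y ^ 2) := by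
  have hp0 : 0 ≤ ν.real {true} := measureReal_nonneg
  have hN0 : (0 : ℝ) ≤ Fintype.card ι := Nat.cast_nonneg _
  have hm0 : (0 : ℝ) ≤ Fintype.card κ := Nat.cast_nonneg _
  refine (integral_abs_numEdges_le ν).trans ?_
  have h1 := sqrt_le_const_mul_sqrt (C := 30 * D ^ 11)
    (moment_two_le hN0 hNn hy hny hD hm hp0 hp) (by
      have := pow_le_pow_right₀ hD (show 5 ≤ 22 by norm_num)
      have : 0 ≤ D ^ 22 := by positivity
      nlinarith) (by positivity) (by positivity)
  have h2 := pair_error_le (N := Fintype.card ι) hny hD hm0 hm hp0 hp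
  have h3 : D ^ 6 * ((Fintype.card ι : ℝ) ^ 2 * y ^ 2) ≤
      30 * D ^ 11 * ((Fintype.card ι : ℝ) ^ 2 * y ^ 2) := by
    have h4 := pow_le_pow_right₀ hD (show 6 ≤ 11 by norm_num)
    gcongr
    linarith [pow_nonneg (by linarith : 0 ≤ D) 6]
  linarith

theorem integral_abs_numTriangles_le_const (hNn : (Fintype.card ι : ℝ) ≤ n) (hy : 0 ≤ y)
    (hny : n * y = 1) (hD : 1 ≤ D) (hm : (Fintype.card κ : ℝ) ≤ D * n)
    (hp : ν.real {true} ≤ D * y) :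
    ∫ ω, |6 * (numTriangles (attrGraph ω) : ℝ) -
      Fintype.card κ * (Fintype.card ι * (Fintype.card ι - 1) * (Fintype.card ι - 2) *
        ν.real {true} ^ 3)| ∂matrixLaw κ ι ν ≤
    30 * D ^ 11 * (√((Fintype.card ι : ℝ) ^ 3 * y ^ 2) + (Fintype.card ι : ℝ) ^ 3 * y ^ 3) := by
  have hp0 : 0 ≤ ν.real {true} := measureReal_nonneg
  have hN0 : (0 : ℝ) ≤ Fintype.card ι := Nat.cast_nonneg _
  have hm0 : (0 : ℝ) ≤ Fintype.card κ := Nat.cast_nonneg _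
  have hn0 := hN0.trans hNn
  refine (integral_abs_numTriangles_le ν).trans ?_
  have h1 := sqrt_le_const_mul_sqrt (C := 30 * D ^ 11)
    (moment_three_le hN0 hNn hy hny hD hm hp0 hp) (by
      have := pow_le_pow_right₀ hD (show 7 ≤ 22 by norm_num)
      have : 0 ≤ D ^ 22 := by positivity
      nlinarith) (by positivity) (by positivity)
  have h2 := triple_error_le hN0 hn0 hy hny hD hm0 hm hp0 hp
  have h2' := rainbow_error_le hN0 hn0 hny hD hm0 hm hp0 hp
  have h3 : 4 * D ^ 9 * ((Fintype.card ι : ℝ) ^ 3 * y ^ 3) ≤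
      30 * D ^ 11 * ((Fintype.card ι : ℝ) ^ 3 * y ^ 3) := by
    have h4 := pow_le_pow_right₀ hD (show 9 ≤ 11 by norm_num)
    gcongr
    linarith [pow_nonneg (by linarith : 0 ≤ D) 9]
  linarith

theorem integral_abs_numTwoStars_le_const [Nonempty κ] [Nonempty ι]
    (hNn : (Fintype.card ι : ℝ) ≤ n) (hy : 0 ≤ y)
    (hny : n * y = 1) (hD : 1 ≤ D) (hm : (Fintype.card κ : ℝ) ≤ D * n)
    (hp : ν.real {true} ≤ D * y) :
    ∫ ω, |2 * (numTwoStars (attrGraph ω) : ℝ) -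
      (Fintype.card ι * Fintype.card κ * (Fintype.card κ - 1) *
        ((Fintype.card ι - 1) * ν.real {true} ^ 2) ^ 2 +
      Fintype.card κ * (Fintype.card ι * (Fintype.card ι - 1) * (Fintype.card ι - 2) *
        ν.real {true} ^ 3))| ∂matrixLaw κ ι ν ≤
    30 * D ^ 11 * (√((Fintype.card ι : ℝ) ^ 3 * y ^ 2) + (Fintype.card ι : ℝ) ^ 3 * y ^ 3 +
      (Fintype.card ι : ℝ) ^ 2 * y ^ 2) := by
  classical
  have hp0 : 0 ≤ ν.real {true} := measureReal_nonneg
  have hN0 : (0 : ℝ) ≤ Fintype.card ι := Nat.cast_nonneg _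
  have hN1 : (1 : ℝ) ≤ Fintype.card ι := Nat.one_le_cast.2 Fintype.card_pos
  have hm0 : (0 : ℝ) ≤ Fintype.card κ := Nat.cast_nonneg _
  have hn0 := hN0.trans hNn
  have hD0 : 0 ≤ D := by linarith
  refine (integral_abs_numTwoStars_le ν).trans ?_
  set p := ν.real {true}
  set N : ℝ := (Fintype.card ι : ℝ)
  set m : ℝ := (Fintype.card κ : ℝ)
  have hDp : ∀ k, k ≤ 22 → D ^ k ≤ D ^ 22 := fun k hk => pow_le_pow_right₀ hD hk
  have h22 : 0 ≤ D ^ 22 := by positivity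
  have h1 : 2 * m * N * p ^ 2 * √(m * ((N * p) ^ 4 + 4 * (N * p) ^ 3 + 2 * (N * p) ^ 2)) ≤
      8 * D ^ 11 * √(N ^ 3 * y ^ 2) := by
    -- With the prefactor under the root, the radicand carries a spare factor `N * y ≤ 1`, dropped
    -- to reach the scale `N ^ 3 * y ^ 2`. This is the source of the exponent 11: 6 from the squared
    -- prefactor and 5 from the moment bound.
    rw [← Real.sqrt_sq (by positivity : 0 ≤ 2 * m * N * p ^ 2), ← Real.sqrt_mul (sq_nonneg _)]
    refine sqrt_le_const_mul_sqrt (c := 28 * D ^ 11) ?_ ?_ (by positivity) (by positivity)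
    · calc _ ≤ (2 * m * N * p ^ 2) ^ 2 * (7 * D ^ 5 * (N ^ 2 * y)) :=
            mul_le_mul_of_nonneg_left (moment_two_le hN0 hNn hy hny hD hm hp0 hp)
              (sq_nonneg _)
        _ ≤ (2 * (D * n) * N * (D * y) ^ 2) ^ 2 * (7 * D ^ 5 * (N ^ 2 * y)) := by gcongr
        _ = 28 * D ^ 11 * (N ^ 3 * y ^ 2) * (N * y) * (n * y) ^ 2 := by ring
        _ ≤ 28 * D ^ 11 * (N ^ 3 * y ^ 2) * (n * y) * (n * y) ^ 2 := by gcongr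
        _ = _ := by rw [hny]; ring
    · nlinarith [hDp 11 (by norm_num)]
  have h2 := sqrt_le_const_mul_sqrt (C := 8 * D ^ 11)
    (chaos_error_le hN1 hNn hny hD hm0 hm hp0 hp)
    (by nlinarith [hDp 10 (by norm_num)]) (by positivity) (by positivity)
  have h3 := sqrt_le_const_mul_sqrt (C := 8 * D ^ 11)
    (moment_three_le hN0 hNn hy hny hD hm hp0 hp)
    (by nlinarith [hDp 7 (by norm_num)]) (by positivity) (by positivity)
  have h4 := pair_error_le (N := N) hny hD hm0 hm hp0 hp
  have h5 := triple_error_le hN0 hn0 hy hny hD hm0 hm hp0 hp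
  have h6 : 6 * D ^ 9 * (N ^ 3 * y ^ 3) ≤ 30 * D ^ 11 * (N ^ 3 * y ^ 3) := by
    have h4 := pow_le_pow_right₀ hD (show 9 ≤ 11 by norm_num)
    gcongr
    linarith [pow_nonneg hD0 9]
  have h7 : D ^ 6 * (N ^ 2 * y ^ 2) ≤ 30 * D ^ 11 * (N ^ 2 * y ^ 2) := by
    have h4 := pow_le_pow_right₀ hD (show 6 ≤ 11 by norm_num)
    gcongr
    linarith [pow_nonneg hD0 6]
  have h8 : 0 ≤ D ^ 11 * √(N ^ 3 * y ^ 2) := by positivity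
  linarith

end Bounds

/-! ### Reduction to a fixed node set and a product measure -/

section Transfer

theorem measurableSet_simpleGraph {W : Type*} [Finite W] (s : Set (SimpleGraph W)) :
    MeasurableSet s := by
  refine ⟨SimpleGraph.Adj '' s, (Set.toFinite _).measurableSet, ?_⟩
  exact Set.preimage_image_eq _ fun G H h => SimpleGraph.ext h

/-- On a finite space it suffices to compare singletons, whose mass is a product over the entries by
independence. -/
theorem map_eq_matrixLaw {Ω κ ι : Type*} [MeasurableSpace Ω] (P : Measure Ω) [Fintype κ]
    [Fintype ι] (X : ι × κ → Ω → Bool) (hX : ∀ e, Measurable (X e)) (hind : iIndepFun X P)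
    (ν : Measure Bool) [IsProbabilityMeasure ν] (hν : ∀ e, P.map (X e) = ν) :
    P.map (fun ω k i => X (i, k) ω) = matrixLaw κ ι ν := by
  have hXm : Measurable fun ω k i => X (i, k) ω :=
    measurable_pi_lambda _ fun k => measurable_pi_lambda _ fun i => hX (i, k)
  refine Measure.ext_of_singleton fun x => ?_
  rw [Measure.map_apply hXm (measurableSet_singleton x), Measure.pi_singleton]
  have h1 : (fun ω k i => X (i, k) ω) ⁻¹' {x} = ⋂ e : ι × κ, X e ⁻¹' {x e.2 e.1} := by
    ext ω
    simp only [Set.mem_preimage, Set.mem_singleton_iff, Set.mem_iInter, Prod.forall]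
    exact ⟨fun h i k => by rw [← h], fun h => funext fun k => funext fun i => h i k⟩
  rw [h1, hind.meas_iInter fun e => ⟨{x e.2 e.1}, measurableSet_singleton _, rfl⟩,
    Fintype.prod_prod_type_right]
  refine Finset.prod_congr rfl fun k _ => ?_
  rw [Measure.pi_singleton]
  refine Finset.prod_congr rfl fun i _ => ?_
  rw [← Measure.map_apply (hX _) (measurableSet_singleton _), hν]

theorem ext_of_real_true {ν ν' : Measure Bool} [IsProbabilityMeasure ν] [IsProbabilityMeasure ν']
    (h : ν.real {true} = ν'.real {true}) : ν = ν' := by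
  have ht : ν {true} = ν' {true} := by
    rwa [← ENNReal.toReal_eq_toReal_iff' (measure_ne_top _ _) (measure_ne_top _ _)]
  refine Measure.ext_of_singleton fun b => ?_
  cases b
  · have : ({false} : Set Bool) = {true}ᶜ := by ext b; cases b <;> simp
    rw [this, prob_compl_eq_one_sub (measurableSet_singleton _),
      prob_compl_eq_one_sub (measurableSet_singleton _), ht]
  · exact ht

variable {Ω : Type*} [MeasurableSpace Ω] (P : Measure Ω) {n m n₀ : ℕ}
  {p : ℝ} {B : Fin n → Fin m → Ω → ℕ}

theorem real_map_decide (hB : IsBinomialAssignment P n m p B) (i : Fin n) (k : Fin m) :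
    (P.map fun ω => decide (B i k ω = 1)).real {true} = p := by
  have hm : MeasurableSet {ω | B i k ω = 1} := hB.measurable i k (measurableSet_singleton 1)
  have hdec : Measurable fun ω => decide (B i k ω = 1) :=
    (Measurable.of_discrete.comp (hB.measurable i k) :
      Measurable ((fun b : ℕ => decide (b = 1)) ∘ B i k))
  rw [map_measureReal_apply hdec (measurableSet_singleton _), ← hB.mean i k]
  have h : ∀ ω, (B i k ω : ℝ) = Set.indicator {ω | B i k ω = 1} 1 ω := by
    intro ω
    rcases hB.zero_or_one i k ω with h | h <;> simp [Set.indicator, h]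
  simp_rw [h]
  rw [integral_indicator_one hm]
  congr 1
  ext ω
  simp

theorem induce_intersectionGraph (b : Fin n → Fin m → ℕ) (s : Set (Fin n)) :
    (intersectionGraph b).induce s = attrGraph fun k (i : s) => decide (b i k = 1) := by
  ext i j
  simp [intersectionGraph, attrGraph, attributeSet, Set.Nonempty, Subtype.ext_iff]

/-- An upper bound for the probability of an event that concerns the subgraph induced by a random
node set, in terms of random graphs with a fixed node set of the same size. -/
theorem measure_induce_le [IsProbabilityMeasure P] (hn : 0 < n) (hm : 0 < m) (hB : IsBinomialAssignment P n m p B)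
    (G : Ω → SimpleGraph (Fin n)) (hG : ∀ ω, G ω = intersectionGraph fun i k => B i k ω)
    (V : Ω → Finset (Fin n)) (hVmeas : Measurable V) (hVcard : ∀ᵐ ω ∂P, (V ω).card = n₀) (hVindep : IndepFun V G P)
    (bad : ∀ (s : Set (Fin n)) [Fintype s], SimpleGraph s → Prop) (δ : ENNReal)
    (hδ : ∀ (ν : Measure Bool) [IsProbabilityMeasure ν] (s : Set (Fin n)) [Fintype s],
      ν.real {true} = p → Fintype.card s = n₀ →
        matrixLaw (Fin m) s ν {ω | bad s (attrGraph ω)} ≤ δ) :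
    P {ω | bad {i | i ∈ V ω} ((G ω).induce {i | i ∈ V ω})} ≤ δ := by
  classical
  -- All entries have the same law, as a law on `Bool` is fixed by its mass at `true`. The reference
  -- entry exists because `n` and `m` are positive.
  set ν := P.map fun ω => decide (B ⟨0, hn⟩ ⟨0, hm⟩ ω = 1) with hν
  have hdec : ∀ i k, Measurable fun ω => decide (B i k ω = 1) := fun i k =>
    (Measurable.of_discrete.comp (hB.measurable i k) :
      Measurable ((fun b : ℕ => decide (b = 1)) ∘ B i k))
  have hprob : ∀ i k, IsProbabilityMeasure (P.map fun ω => decide (B i k ω = 1)) := fun i k =>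
    Measure.isProbabilityMeasure_map (hdec i k).aemeasurable
  have : IsProbabilityMeasure ν := hprob _ _
  have hlaw : ∀ i k, (P.map fun ω => decide (B i k ω = 1)) = ν := fun i k => by
    have := hprob i k
    exact ext_of_real_true (by rw [hν, real_map_decide P hB, real_map_decide P hB])
  have hone : ∀ S : Finset (Fin n), S.card = n₀ →
      P (G ⁻¹' {g | bad {i | i ∈ S} (g.induce {i | i ∈ S})}) ≤ δ := by
    intro S hS
    refine le_trans (le_of_eq ?_) (hδ ν {i | i ∈ S} (real_map_decide P hB _ _)
      (by simpa using hS))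
    have hind : iIndepFun (fun (e : ({i | i ∈ S} : Set (Fin n)) × Fin m) ω =>
        decide (B e.1 e.2 ω = 1)) P := by
      have h1 := hB.indep.precomp (g := fun e : ({i | i ∈ S} : Set (Fin n)) × Fin m =>
        ((e.1 : Fin n), e.2)) fun e f h =>
          Prod.ext (Subtype.ext (Prod.ext_iff.1 h).1) (Prod.ext_iff.1 h).2
      exact h1.comp (fun _ b => decide (b = 1)) fun _ => Measurable.of_discrete
    rw [← map_eq_matrixLaw P (fun (e : ({i | i ∈ S} : Set (Fin n)) × Fin m) ω =>
        decide (B e.1 e.2 ω = 1)) (fun e => hdec _ _) hind ν fun e => hlaw _ _,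
      Measure.map_apply (measurable_pi_lambda _ fun k => measurable_pi_lambda _ fun i => hdec _ _)
        (Set.toFinite _).measurableSet]
    congr 1
    ext ω
    simp only [Set.mem_preimage, Set.mem_ofPred_eq]
    rw [hG, induce_intersectionGraph]
  -- Split according to the value `S` of `V`, discarding the null event of a wrong size.
  -- Independence gives each piece mass at most `P (V = S) * δ`, and the weights sum to at most 1.
  calc P {ω | bad {i | i ∈ V ω} ((G ω).induce {i | i ∈ V ω})}
      ≤ P ({ω | ¬ (V ω).card = n₀} ∪ ⋃ S ∈ (Finset.univ.filter fun S : Finset (Fin n) =>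
          S.card = n₀), V ⁻¹' {S} ∩ G ⁻¹' {g | bad {i | i ∈ S} (g.induce {i | i ∈ S})}) := by
        refine measure_mono fun ω hω => ?_
        by_cases hc : (V ω).card = n₀
        · right
          simp only [Set.mem_iUnion]
          exact ⟨V ω, by simpa using hc, rfl, hω⟩
        · exact Or.inl hc
    _ ≤ 0 + ∑ S ∈ (Finset.univ.filter fun S : Finset (Fin n) => S.card = n₀),
          P (V ⁻¹' {S}) * δ := by
        refine (measure_union_le _ _).trans (add_le_add (le_of_eq hVcard) ?_)
        refine (measure_biUnion_finset_le _ _).trans (Finset.sum_le_sum fun S hS => ?_)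
        rw [hVindep.measure_inter_preimage_eq_mul _ _ (measurableSet_singleton S)
          (measurableSet_simpleGraph _)]
        gcongr
        exact hone S (Finset.mem_filter.1 hS).2
    _ ≤ 1 * δ := by
        rw [zero_add, ← Finset.sum_mul]
        gcongr
        rw [sum_measure_preimage_singleton _ fun S _ => hVmeas (measurableSet_singleton S)]
        exact prob_le_one
    _ = δ := one_mul δ

end Transfer

/-! ### Estimators as functions of normalized counts, and Markov's inequality -/

section Estimators

variable {W : Type*} [Fintype W] (H : SimpleGraph W)

theorem muHat₁_eq {s : ℝ} (hs : s ≠ 0) :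
    muHat₁ H = (2 * (numTwoStars H : ℝ) / s) / (6 * (numTriangles H : ℝ) / s) - 1 := by
  rw [muHat₁, div_div_div_cancel_right₀ hs, show (6 : ℝ) * numTriangles H = 2 * (3 * numTriangles H)
    by ring, mul_div_mul_left _ _ (two_ne_zero)]

theorem muHat₂_eq {n : ℝ} (hn : n ≠ 0) (hW : (Fintype.card W : ℝ) ≠ 0) :
    muHat₂ H = ((2 * (numTwoStars H : ℝ) / ((Fintype.card W : ℝ) ^ 3 * n⁻¹ ^ 2)) /
      (2 * (numEdges H : ℝ) / ((Fintype.card W : ℝ) ^ 2 * n⁻¹)) ^ 2 - 1)⁻¹ := by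
  rw [muHat₂]
  congr 2
  -- Without edges both quotients are 0 by the convention for division by zero, so the identity
  -- holds there too.
  rcases eq_or_ne (numEdges H : ℝ) 0 with h | h
  · simp [h]
  · field_simp

/-- Markov's inequality, with the deviation from the limit `a` split into a random part around the
centre `c` and the bias of `c / s`. -/
theorem meas_le_of_integral_abs_le {α : Type*} [MeasurableSpace α] [Finite α]
    [MeasurableSingletonClass α] (γ : Measure α) [IsProbabilityMeasure γ] (Y : α → ℝ)
    {c b s a t : ℝ} (hs : 0 < s) (ht : 0 < t) (h : ∫ ω, |Y ω - c| ∂γ ≤ b) :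
    γ {ω | t ≤ |Y ω / s - a|} ≤ ENNReal.ofReal ((b / s + |c / s - a|) / t) := by
  have h1 := mul_meas_ge_le_integral_of_nonneg (μ := γ) (f := fun ω => |Y ω / s - a|)
    (.of_forall fun ω => abs_nonneg _) .of_finite t
  have h2 : ∫ ω, |Y ω / s - a| ∂γ ≤ b / s + |c / s - a| := by
    calc _ ≤ ∫ ω, (|Y ω - c| / s + |c / s - a|) ∂γ := by
          refine integral_mono .of_finite .of_finite fun ω => ?_
          have := abs_add_le ((Y ω - c) / s) (c / s - a)
          rw [abs_div, abs_of_pos hs, sub_div, sub_add_sub_cancel] at this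
          exact this
      _ = (∫ ω, |Y ω - c| ∂γ) / s + |c / s - a| := by
          rw [integral_add .of_finite .of_finite, integral_div]
          simp
      _ ≤ _ := by gcongr
  rw [← ofReal_measureReal (measure_ne_top _ _)]
  refine ENNReal.ofReal_le_ofReal ?_
  rw [le_div_iff₀ ht]
  linarith

end Estimators

/-! ### Limits in the balanced sparse regime -/

section Asymptotics

variable {n m n₀ : ℕ → ℕ} {p : ℕ → ℝ} {lam μ : ℝ}

theorem IsBalancedSparse.tendsto_m_div (h : IsBalancedSparse n m p lam μ) :
    Tendsto (fun ν => (m ν : ℝ) * (n ν : ℝ)⁻¹) atTop (𝓝 (μ ^ 2 / lam)) := by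
  have hn : Tendsto (fun ν => (n ν : ℝ)) atTop atTop :=
    tendsto_natCast_atTop_atTop.comp h.n_tendsto
  have h1 : (fun ν => (m ν : ℝ) * (n ν : ℝ)⁻¹) ~[atTop]
      fun ν => μ ^ 2 / lam * (n ν : ℝ) * (n ν : ℝ)⁻¹ := h.m_equiv.mul IsEquivalent.refl
  refine h1.symm.tendsto_nhds (tendsto_const_nhds.congr' ?_)
  filter_upwards [hn.eventually_gt_atTop 0] with ν hν
  rw [mul_assoc, mul_inv_cancel₀ hν.ne', mul_one]

theorem IsBalancedSparse.tendsto_p_mul (h : IsBalancedSparse n m p lam μ) :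
    Tendsto (fun ν => p ν * (n ν : ℝ)) atTop (𝓝 (lam / μ)) := by
  have hn : Tendsto (fun ν => (n ν : ℝ)) atTop atTop :=
    tendsto_natCast_atTop_atTop.comp h.n_tendsto
  have h1 : (fun ν => p ν * (n ν : ℝ)) ~[atTop]
      fun ν => lam / μ * (n ν : ℝ)⁻¹ * (n ν : ℝ) := h.p_equiv.mul IsEquivalent.refl
  refine h1.symm.tendsto_nhds (tendsto_const_nhds.congr' ?_)
  filter_upwards [hn.eventually_gt_atTop 0] with ν hν
  rw [mul_assoc, inv_mul_cancel₀ hν.ne', mul_one]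

/-- The scale is the cube of `n₀ / n ^ (2/3)`. The growth hypothesis enters the asymptotics only
here: the other divergences follow from this one and `n₀ ≤ n`. -/
theorem tendsto_cube_scale (hn : Tendsto (fun ν => (n ν : ℝ)) atTop atTop)
    (hn₀ : (fun ν => (n ν : ℝ) ^ (2 / 3 : ℝ)) =o[atTop] fun ν => (n₀ ν : ℝ)) :
    Tendsto (fun ν => (n₀ ν : ℝ) ^ 3 * (n ν : ℝ)⁻¹ ^ 2) atTop atTop := by
  have h1 := (hn₀.tendsto_div_nhds_zero).pow 3
  have h2 : Tendsto (fun ν => ((n₀ ν : ℝ) ^ 3 * (n ν : ℝ)⁻¹ ^ 2)⁻¹) atTop (𝓝 0) := by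
    refine (h1.congr fun ν => ?_).trans (by norm_num)
    rw [div_pow, ← Real.rpow_natCast ((n ν : ℝ) ^ (2 / 3 : ℝ)) 3, ← Real.rpow_mul (Nat.cast_nonneg _)]
    norm_num
    rw [mul_comm, div_eq_mul_inv]
    norm_cast
    exact mul_comm _ _
  have hpos : ∀ᶠ ν in atTop, 0 < (n₀ ν : ℝ) := by
    filter_upwards [hn₀.bound one_pos, hn.eventually_gt_atTop 0] with ν h hν
    have h3 : 0 < (n ν : ℝ) ^ (2 / 3 : ℝ) := Real.rpow_pos_of_pos hν _
    rw [Real.norm_of_nonneg h3.le, Real.norm_of_nonneg (Nat.cast_nonneg _), one_mul] at h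
    linarith
  have h3 : Tendsto (fun ν => ((n₀ ν : ℝ) ^ 3 * (n ν : ℝ)⁻¹ ^ 2)⁻¹) atTop (𝓝[>] 0) := by
    refine tendsto_nhdsWithin_iff.2 ⟨h2, ?_⟩
    filter_upwards [hpos, hn.eventually_gt_atTop 0] with ν h hν
    exact Set.mem_Ioi.2 (by positivity)
  exact h3.inv_tendsto_nhdsGT_zero.congr fun ν => inv_inv _

theorem tendsto_error {s r x : ℕ → ℝ} {C a : ℝ} (hs : Tendsto s atTop atTop)
    (hr : Tendsto (fun ν => r ν / s ν) atTop (𝓝 0)) (hx : Tendsto (fun ν => x ν / s ν) atTop (𝓝 a)) :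
    Tendsto (fun ν => C * (√(s ν) + r ν) / s ν + |x ν / s ν - a|) atTop (𝓝 0) := by
  have h1 : Tendsto (fun ν => C * ((√(s ν))⁻¹ + r ν / s ν) + |x ν / s ν - a|) atTop
      (𝓝 (C * (0 + 0) + |a - a|)) :=
    (((Real.tendsto_sqrt_atTop.comp hs).inv_tendsto_atTop.add hr).const_mul C).add
      (hx.sub_const a).abs
  simp only [add_zero, mul_zero, sub_self, abs_zero] at h1
  refine h1.congr' ?_
  filter_upwards [hs.eventually_gt_atTop 0] with ν hν
  rw [← Real.sqrt_div_self, mul_div_assoc, add_div]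

/-- Uniformly over the node sets of size `n₀`, the normalized numbers of edges, triangles and
2-stars concentrate around their limits. -/
theorem exists_concentration_bound (hlam : 0 < lam) (hμ : 0 < μ)
    (hreg : IsBalancedSparse n m p lam μ) (hle : ∀ ν, n₀ ν ≤ n ν)
    (hn₀ : (fun ν => (n ν : ℝ) ^ (2 / 3 : ℝ)) =o[atTop] fun ν => (n₀ ν : ℝ)) {t : ℝ} (ht : 0 < t) :
    ∃ δ : ℕ → ENNReal, Tendsto δ atTop (𝓝 0) ∧ ∀ᶠ ν in atTop, 0 < n ν ∧ 0 < m ν ∧ 0 < n₀ ν ∧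
      ∀ (θ : Measure Bool) [IsProbabilityMeasure θ] (s : Set (Fin (n ν))) [Fintype s],
        θ.real {true} = p ν → Fintype.card s = n₀ ν →
        matrixLaw (Fin (m ν)) s θ {ω |
          t ≤ |2 * (numEdges (attrGraph ω) : ℝ) / ((n₀ ν : ℝ) ^ 2 * (n ν : ℝ)⁻¹) - lam| ∨
          t ≤ |6 * (numTriangles (attrGraph ω) : ℝ) / ((n₀ ν : ℝ) ^ 3 * (n ν : ℝ)⁻¹ ^ 2) -
            lam ^ 2 / μ| ∨
          t ≤ |2 * (numTwoStars (attrGraph ω) : ℝ) / ((n₀ ν : ℝ) ^ 3 * (n ν : ℝ)⁻¹ ^ 2) -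
            (lam ^ 2 + lam ^ 2 / μ)|} ≤ δ ν := by
  have hn : Tendsto (fun ν => (n ν : ℝ)) atTop atTop :=
    tendsto_natCast_atTop_atTop.comp hreg.n_tendsto
  have hy : Tendsto (fun ν => (n ν : ℝ)⁻¹) atTop (𝓝 0) := hn.inv_tendsto_atTop
  have hle' : ∀ ν, (n₀ ν : ℝ) ≤ n ν := fun ν => Nat.cast_le.2 (hle ν)
  have hs3 := tendsto_cube_scale hn hn₀
  have hratio : ∀ ν, (n₀ ν : ℝ) * (n ν : ℝ)⁻¹ ≤ 1 := fun ν => by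
    rw [← div_eq_mul_inv]; exact div_le_one_of_le₀ (hle' ν) (Nat.cast_nonneg _)
  have hs2 : Tendsto (fun ν => (n₀ ν : ℝ) ^ 2 * (n ν : ℝ)⁻¹) atTop atTop := by
    refine tendsto_atTop_mono (fun ν => ?_) hs3
    calc (n₀ ν : ℝ) ^ 3 * (n ν : ℝ)⁻¹ ^ 2
        = (n₀ ν : ℝ) ^ 2 * (n ν : ℝ)⁻¹ * ((n₀ ν : ℝ) * (n ν : ℝ)⁻¹) := by ring
      _ ≤ _ := mul_le_of_le_one_right (by positivity) (hratio ν)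
  have hN : Tendsto (fun ν => (n₀ ν : ℝ)) atTop atTop := by
    refine tendsto_atTop_mono (fun ν => ?_) hs2
    calc (n₀ ν : ℝ) ^ 2 * (n ν : ℝ)⁻¹ = (n₀ ν : ℝ) * ((n₀ ν : ℝ) * (n ν : ℝ)⁻¹) := by ring
      _ ≤ _ := mul_le_of_le_one_right (by positivity) (hratio ν)
  have hx : Tendsto (fun ν => (n₀ ν : ℝ)⁻¹) atTop (𝓝 0) := hN.inv_tendsto_atTop
  have hm := hreg.tendsto_m_div
  have hp := hreg.tendsto_p_mul
  have hpos : ∀ᶠ ν in atTop, 0 < (n ν : ℝ) ∧ 0 < (n₀ ν : ℝ) :=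
    (hn.eventually_gt_atTop 0).and (hN.eventually_gt_atTop 0)
  -- Strictly larger than the limits of `m / n` and `p n`, hence eventually an upper bound for both,
  -- and at least 1 as the size estimates require.
  set D := μ ^ 2 / lam + lam / μ + 1 with hD
  have hα : 0 < μ ^ 2 / lam := by positivity
  have hβ : 0 < lam / μ := by positivity
  have hD1 : 1 ≤ D := by linarith
  have hone : ∀ a : ℝ, Tendsto (fun ν => 1 - a * (n₀ ν : ℝ)⁻¹) atTop (𝓝 1) := fun a => by
    simpa using (hx.const_mul a).const_sub 1
  -- normalized expectations
  have hE : Tendsto (fun ν => ((m ν : ℝ) * ((n₀ ν : ℝ) * (n₀ ν - 1) * p ν ^ 2)) /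
      ((n₀ ν : ℝ) ^ 2 * (n ν : ℝ)⁻¹)) atTop (𝓝 lam) := by
    have h := (hm.mul (hp.pow 2)).mul (hone 1)
    rw [show μ ^ 2 / lam * (lam / μ) ^ 2 * 1 = lam by field_simp] at h
    refine h.congr' ?_
    filter_upwards [hpos] with ν ⟨h1, h2⟩
    field_simp
  have hT : Tendsto (fun ν => ((m ν : ℝ) * ((n₀ ν : ℝ) * (n₀ ν - 1) * (n₀ ν - 2) * p ν ^ 3)) /
      ((n₀ ν : ℝ) ^ 3 * (n ν : ℝ)⁻¹ ^ 2)) atTop (𝓝 (lam ^ 2 / μ)) := by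
    have h := ((hm.mul (hp.pow 3)).mul (hone 1)).mul (hone 2)
    rw [show μ ^ 2 / lam * (lam / μ) ^ 3 * 1 * 1 = lam ^ 2 / μ by field_simp] at h
    refine h.congr' ?_
    filter_upwards [hpos] with ν ⟨h1, h2⟩
    field_simp
  have hS : Tendsto (fun ν => ((n₀ ν : ℝ) * m ν * (m ν - 1) * ((n₀ ν - 1) * p ν ^ 2) ^ 2 +
      (m ν : ℝ) * ((n₀ ν : ℝ) * (n₀ ν - 1) * (n₀ ν - 2) * p ν ^ 3)) /
      ((n₀ ν : ℝ) ^ 3 * (n ν : ℝ)⁻¹ ^ 2)) atTop (𝓝 (lam ^ 2 + lam ^ 2 / μ)) := by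
    have h := ((hm.mul (hm.sub hy)).mul (hp.pow 4)).mul ((hone 1).pow 2)
    rw [show μ ^ 2 / lam * (μ ^ 2 / lam - 0) * (lam / μ) ^ 4 * 1 ^ 2 = lam ^ 2 by
      field_simp; ring] at h
    refine (h.add hT).congr' ?_
    filter_upwards [hpos] with ν ⟨h1, h2⟩
    rw [add_div]
    congr 1
    field_simp
  -- remainders
  have hr2 : Tendsto (fun ν => (n₀ ν : ℝ) ^ 2 * (n ν : ℝ)⁻¹ ^ 2 / ((n₀ ν : ℝ) ^ 2 * (n ν : ℝ)⁻¹))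
      atTop (𝓝 0) := by
    refine hy.congr' ?_
    filter_upwards [hpos] with ν ⟨h1, h2⟩
    field_simp
  have hr3 : Tendsto (fun ν => (n₀ ν : ℝ) ^ 3 * (n ν : ℝ)⁻¹ ^ 3 /
      ((n₀ ν : ℝ) ^ 3 * (n ν : ℝ)⁻¹ ^ 2)) atTop (𝓝 0) := by
    refine hy.congr' ?_
    filter_upwards [hpos] with ν ⟨h1, h2⟩
    field_simp
  have hr3' : Tendsto (fun ν => ((n₀ ν : ℝ) ^ 3 * (n ν : ℝ)⁻¹ ^ 3 + (n₀ ν : ℝ) ^ 2 * (n ν : ℝ)⁻¹ ^ 2)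
      / ((n₀ ν : ℝ) ^ 3 * (n ν : ℝ)⁻¹ ^ 2)) atTop (𝓝 0) := by
    have h := hr3.add hx
    rw [add_zero] at h
    refine h.congr' ?_
    filter_upwards [hpos] with ν ⟨h1, h2⟩
    rw [add_div]
    congr 1
    field_simp
  have t1 := (tendsto_error (C := 30 * D ^ 11) hs2 hr2 hE).div_const t
  have t2 := (tendsto_error (C := 30 * D ^ 11) hs3 hr3 hT).div_const t
  have t3 := (tendsto_error (C := 30 * D ^ 11) hs3 hr3' hS).div_const t
  have tt := ((ENNReal.tendsto_ofReal t1).add (ENNReal.tendsto_ofReal t2)).add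
    (ENNReal.tendsto_ofReal t3)
  simp only [zero_div, ENNReal.ofReal_zero, add_zero] at tt
  refine ⟨_, tt, ?_⟩
  filter_upwards [hpos, hm.eventually_const_lt hα, hm.eventually_lt_const (show _ < D by linarith),
    hp.eventually_lt_const (show _ < D by linarith)] with ν ⟨hn1, hN1⟩ hm1 hmD hpD
  have hm0 : 0 < m ν := by
    rcases Nat.eq_zero_or_pos (m ν) with h | h
    · simp [h] at hm1
    · exact h
  refine ⟨Nat.cast_pos.1 hn1, hm0, Nat.cast_pos.1 hN1, fun θ _ s _ hθ hs => ?_⟩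
  have : Nonempty (Fin (m ν)) := ⟨⟨0, hm0⟩⟩
  have : Nonempty s := Fintype.card_pos_iff.1 (by rw [hs]; exact Nat.cast_pos.1 hN1)
  have hny : (n ν : ℝ) * (n ν : ℝ)⁻¹ = 1 := mul_inv_cancel₀ hn1.ne'
  have hmD' : (m ν : ℝ) ≤ D * n ν := by
    rw [← div_eq_mul_inv, div_lt_iff₀ hn1] at hmD
    exact hmD.le
  have hpD' : θ.real {true} ≤ D * (n ν : ℝ)⁻¹ := by
    rw [hθ, ← div_eq_mul_inv, le_div_iff₀ hn1]
    exact hpD.le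
  have hmD'' : (Fintype.card (Fin (m ν)) : ℝ) ≤ D * n ν := by simpa using hmD'
  have hsn : (Fintype.card s : ℝ) ≤ n ν := by rw [hs]; exact hle' ν
  have b1 := integral_abs_numEdges_le_const (κ := Fin (m ν)) θ hsn (by positivity) hny hD1 hmD'' hpD'
  have b2 := integral_abs_numTriangles_le_const (κ := Fin (m ν)) θ hsn (by positivity) hny hD1
    hmD'' hpD'
  have b3 := integral_abs_numTwoStars_le_const (κ := Fin (m ν)) θ hsn (by positivity) hny hD1
    hmD'' hpD'
  rw [hs, hθ, Fintype.card_fin] at b1 b2 b3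
  rw [add_assoc (√_)] at b3
  have c1 := meas_le_of_integral_abs_le (matrixLaw (Fin (m ν)) s θ)
    (fun ω => 2 * (numEdges (attrGraph ω) : ℝ)) (a := lam)
    (show 0 < (n₀ ν : ℝ) ^ 2 * (n ν : ℝ)⁻¹ by positivity) ht b1
  have c2 := meas_le_of_integral_abs_le (matrixLaw (Fin (m ν)) s θ)
    (fun ω => 6 * (numTriangles (attrGraph ω) : ℝ)) (a := lam ^ 2 / μ)
    (show 0 < (n₀ ν : ℝ) ^ 3 * (n ν : ℝ)⁻¹ ^ 2 by positivity) ht b2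
  have c3 := meas_le_of_integral_abs_le (matrixLaw (Fin (m ν)) s θ)
    (fun ω => 2 * (numTwoStars (attrGraph ω) : ℝ)) (a := lam ^ 2 + lam ^ 2 / μ)
    (show 0 < (n₀ ν : ℝ) ^ 3 * (n ν : ℝ)⁻¹ ^ 2 by positivity) ht b3
  rw [add_assoc]
  exact (measure_union_le _ _).trans
    (add_le_add c1 ((measure_union_le _ _).trans (add_le_add c2 c3)))

theorem exists_pos_forall_abs_sub_lt {f : ℝ × ℝ × ℝ → ℝ} {a b c : ℝ}
    (hf : ContinuousAt f (a, b, c)) {ε : ℝ} (hε : 0 < ε) :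
    ∃ t > 0, ∀ x y z, |x - a| < t → |y - b| < t → |z - c| < t →
      |f (x, y, z) - f (a, b, c)| < ε := by
  obtain ⟨t, ht, h⟩ := Metric.continuousAt_iff.1 hf ε hε
  refine ⟨t, ht, fun x y z hx hy hz => ?_⟩
  rw [← Real.dist_eq]
  apply h
  simp only [Prod.dist_eq, Real.dist_eq]
  exact max_lt hx (max_lt hy hz)

/-- Consistency of an estimator that is a continuous function of the normalized numbers of edges,
triangles and 2-stars. -/
theorem tendstoInProbability_induce {Ω : ℕ → Type*} [∀ ν, MeasurableSpace (Ω ν)]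
    (P : ∀ ν, Measure (Ω ν)) [∀ ν, IsProbabilityMeasure (P ν)] (hlam : 0 < lam) (hμ : 0 < μ)
    (hreg : IsBalancedSparse n m p lam μ) (B : ∀ ν, Fin (n ν) → Fin (m ν) → Ω ν → ℕ)
    (hB : ∀ ν, IsBinomialAssignment (P ν) (n ν) (m ν) (p ν) (B ν))
    (G : ∀ ν, Ω ν → SimpleGraph (Fin (n ν)))
    (hG : ∀ ν ω, G ν ω = intersectionGraph (fun i k => B ν i k ω))
    (V : ∀ ν, Ω ν → Finset (Fin (n ν))) (hVmeas : ∀ ν, Measurable (V ν))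
    (hVcard : ∀ ν, ∀ᵐ ω ∂(P ν), (V ν ω).card = n₀ ν)
    (hVindep : ∀ ν, IndepFun (V ν) (G ν) (P ν))
    (hn₀ : (fun ν => (n ν : ℝ) ^ (2 / 3 : ℝ)) =o[atTop] fun ν => (n₀ ν : ℝ))
    (est : ∀ {W : Type} [Fintype W], SimpleGraph W → ℝ) (f : ℝ × ℝ × ℝ → ℝ)
    (hf : ContinuousAt f (lam, lam ^ 2 / μ, lam ^ 2 + lam ^ 2 / μ))
    (hfμ : f (lam, lam ^ 2 / μ, lam ^ 2 + lam ^ 2 / μ) = μ)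
    (hest : ∀ {W : Type} [Fintype W] (H : SimpleGraph W) (x : ℝ), x ≠ 0 →
      (Fintype.card W : ℝ) ≠ 0 → est H =
        f (2 * (numEdges H : ℝ) / ((Fintype.card W : ℝ) ^ 2 * x⁻¹),
          6 * (numTriangles H : ℝ) / ((Fintype.card W : ℝ) ^ 3 * x⁻¹ ^ 2),
          2 * (numTwoStars H : ℝ) / ((Fintype.card W : ℝ) ^ 3 * x⁻¹ ^ 2))) :
    TendstoInProbability P (fun ν ω => est ((G ν ω).induce {i : Fin (n ν) | i ∈ V ν ω})) μ := by
  intro ε hε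
  obtain ⟨t, ht, hft⟩ := exists_pos_forall_abs_sub_lt hf hε
  rw [hfμ] at hft
  -- An almost sure event of a probability measure is nonempty, so some subset of the `n` nodes has
  -- size `n₀`.
  have hle : ∀ ν, n₀ ν ≤ n ν := fun ν => by
    obtain ⟨ω, hω⟩ := (hVcard ν).exists
    rw [← hω]
    simpa using Finset.card_le_univ (V ν ω)
  obtain ⟨δ, hδ, hbound⟩ := exists_concentration_bound hlam hμ hreg hle hn₀ ht
  refine tendsto_of_tendsto_of_tendsto_of_le_of_le' tendsto_const_nhds hδ
    (.of_forall fun ν => zero_le) ?_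
  filter_upwards [hbound] with ν ⟨h1, h2, h3, h4⟩
  refine measure_induce_le (P ν) h1 h2 (hB ν) (G ν) (hG ν) (V ν) (hVmeas ν) (hVcard ν) (hVindep ν)
    (fun s _ H => ε ≤ |est H - μ|) (δ ν) fun θ _ s _ hθ hs => ?_
  refine le_trans (measure_mono fun ω hω => ?_) (h4 θ s hθ hs)
  by_contra hcon
  simp only [Set.mem_ofPred_eq, not_or, not_le] at hcon hω
  rw [hest (attrGraph ω) (n ν) (by positivity) (by rw [hs]; positivity), hs] at hω
  exact absurd (hft _ _ _ hcon.1 hcon.2.1 hcon.2.2) (not_lt.2 hω)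

end Asymptotics

/-! ### Consistency of the two estimators -/

theorem theorem3 {Ω : ℕ → Type*} [∀ ν, MeasurableSpace (Ω ν)] (P : ∀ ν, Measure (Ω ν))
    [∀ ν, IsProbabilityMeasure (P ν)]
    (lam μ : ℝ) (hlam : 0 < lam) (hμ : 0 < μ)
    (n m n₀ : ℕ → ℕ) (p : ℕ → ℝ) (hreg : IsBalancedSparse n m p lam μ)
    -- the random intersection graphs
    (B : ∀ ν, Fin (n ν) → Fin (m ν) → Ω ν → ℕ)
    (hB : ∀ ν, IsBinomialAssignment (P ν) (n ν) (m ν) (p ν) (B ν))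
    (G : ∀ ν, Ω ν → SimpleGraph (Fin (n ν)))
    (hG : ∀ ν ω, G ν ω = intersectionGraph (fun i k => B ν i k ω))
    -- the sampled node sets, of size `n₀`, independent of the graphs
    (V : ∀ ν, Ω ν → Finset (Fin (n ν)))
    (hVmeas : ∀ ν, Measurable (V ν))
    (hVcard : ∀ ν, ∀ᵐ ω ∂(P ν), (V ν ω).card = n₀ ν)
    (hVindep : ∀ ν, IndepFun (V ν) (G ν) (P ν))
    -- `n₀ ≫ n ^ (2 / 3)`
    (hn₀ : (fun ν => (n ν : ℝ) ^ (2 / 3 : ℝ)) =o[atTop] fun ν => (n₀ ν : ℝ)) :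
    TendstoInProbability P
      (fun ν ω => muHat₁ ((G ν ω).induce {i : Fin (n ν) | i ∈ V ν ω})) μ ∧
    TendstoInProbability P
      (fun ν ω => muHat₂ ((G ν ω).induce {i : Fin (n ν) | i ∈ V ν ω})) μ := by
  have ha : lam ^ 2 / μ ≠ 0 := by positivity
  constructor
  · refine tendstoInProbability_induce P hlam hμ hreg B hB G hG V hVmeas hVcard hVindep hn₀
      (fun H => muHat₁ H) (fun x => x.2.2 / x.2.1 - 1) ?_ ?_ fun H x hx hW => ?_
    · refine ContinuousAt.sub (ContinuousAt.div ?_ ?_ ?_) continuousAt_const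
      · fun_prop
      · fun_prop
      · exact ha
    · field_simp
      ring
    · exact muHat₁_eq H (by positivity)
  · refine tendstoInProbability_induce P hlam hμ hreg B hB G hG V hVmeas hVcard hVindep hn₀
      (fun H => muHat₂ H) (fun x => (x.2.2 / x.1 ^ 2 - 1)⁻¹) ?_ ?_ fun H x hx hW => ?_
    · refine ContinuousAt.inv₀ ((ContinuousAt.div (by fun_prop) (by fun_prop)
        (by positivity)).sub continuousAt_const) ?_
      -- The quantity to be inverted tends to `1 / μ ≠ 0`, so the inverse is continuous at the limit
      -- point.
      have : (lam ^ 2 + lam ^ 2 / μ) / lam ^ 2 - 1 = 1 / μ := by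
        field_simp
        ring
      simp only
      rw [this]
      positivity
    · have : (lam ^ 2 + lam ^ 2 / μ) / lam ^ 2 - 1 = 1 / μ := by
        field_simp
        ring
      simp only
      rw [this, one_div, inv_inv]
    · exact muHat₂_eq H hx hW
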